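/- Let $V=\mathbb{C}[x_1,x_2,\dots]$ be the free bosonic vertex algebra: its vacuum vector is $1$, and its products $a_{(n)}b$ ($n\in\mathbb{Z}$) are given by $Y(a,z)=\sum_n a_{(n)}z^{-n-1}$, linear in $a$, with $$Y(x_{i_1}\cdots x_{i_k},z)={:}\partial^{(i_1-1)}\alpha(z)\cdots\partial^{(i_k-1)}\alpha(z){:},\qquad \alpha(z)=\sum_{n\in\mathbb{Z}}\alpha_n z^{-n-1},$$ where $\alpha_n=n\,\partial/\partial x_n$ for $n>0$, $\alpha_0=0$, $\alpha_n=x_{-n}$ for $n<0$, $\partial^{(j)}=\partial_z^j/j!$, and $:\ :$ is the nested normally ordered product. Its translation is $Ta=a_{(-2)}1$. A conformal vector of $V$ is a non-zero vector $v$ such that, for some $c\in\mathbb{C}$, $v_{(n)}v=0$ for $n\ge 4$, $v_{(3)}v=\frac{c}{2}1$, $v_{(2)}v=0$, $v_{(1)}v=2v$, $v_{(0)}v=Tv$, and such that $v_{(1)}$ is semisimple and $v_{(0)}=T$ as operators on $V$. An automorphism of $V$ is a linear bijection that preserves all the products. An inner automorphism of level $m\ge 0$ is an element of the group generated by the automorphisms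 of the form $\exp(a_{(m)})$, where $a\in V$ satisfies $a_{(0)}=\dots=a_{(m-1)}=0$ (so that $a_{(m)}$ is a derivation for all the products) and the exponential series converges on every vector, within a finite-dimensional subspace. The group $\operatorname{Inn}V$ of inner automorphisms is generated by those of all levels $m\ge0$. The degree on $V$ is given by $\deg x_i=i$. **Corollary.** For every $a\in\mathbb{C}$, $\tau_a=\exp(a\alpha_1)=\exp\left(a\frac{\partial}{\partial x_1}\right)$ is an inner automorphism of $V$ of level $1$. For every conformal vector $v$ of $V$ the following hold. 1. There is a unique conformal vector $w$ of the form $w=\frac12x_1^2+\lambda x_2$ with $\lambda\in\mathbb{C}$ such that $w=\sigma(v)$ for some inner automorphism $\sigma\in\operatorname{Inn}V$. 2. There are $\mu,\lambda\in\mathbb{C}$ such that $v=\frac12\mu^2+\mu x_1+\frac12x_1^2+\lambda x_2$ and $\tau_{-\mu}(v)=\frac12x_1^2+\lambda x_2$; moreover, for $a\in\mathbb{C}$, $\tau_a(v)$ is of the form $\frac12x_1^2+\lambda' x_2$ with $\lambda'\in\mathbb{C}$ if and only if $a=-\mu$, and $\tau_a(v)$ is homogeneous of degree $2$ if and only if $a=-\mu$.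 -/

import Mathlib

open scoped VertexOperator

/-- The Fock space `ℂ[x₁, x₂, …]`, the polynomial ring in variables indexed by the positive
integers. -/
abbrev Fock : Type := MvPolynomial ℕ+ ℂ

/-- The operators `α_n` of the Fock representation of charge `0` of the Heisenberg algebra:
`α_n = n ∂/∂x_n` for `n > 0`, `α_0 = 0`, and `α_n` is multiplication by `x_{-n}` for `n < 0`. -/
noncomputable def heis : ℤ → Module.End ℂ Fock
  | Int.ofNat 0 => 0
  | Int.ofNat (n + 1) => ((n + 1 : ℕ) : ℂ) • (MvPolynomial.pderiv n.succPNat).toLinearMap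
  | Int.negSucc n => LinearMap.mulLeft ℂ (MvPolynomial.X n.succPNat)

/-!
A field `A(z) = ∑ A_n z^{-n-1}` on the Fock space is a term of `VertexOperator ℂ Fock`, that is, a
linear map from `Fock` to Laurent series over `Fock` with finitely many terms of negative degree.
Its Fourier mode `A_n` is `A[[n]]`.
-/

/-- The modes of a field vanish on a given vector from some index on. -/
theorem field_modes_vanish (A : VertexOperator ℂ Fock) (v : Fock) :
    ∃ N : ℤ, ∀ n, N ≤ n → (A[[n]]) v = 0 := by
  refine ⟨-(HahnSeries.order ((HahnModule.of ℂ).symm (A v))), fun n hn => ?_⟩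
  exact VertexOperator.ncoeff_eq_zero_of_lt_order A n v (by omega)

/-- Build a field from its Fourier modes. -/
noncomputable def fieldOfModes (f : ℤ → Module.End ℂ Fock)
    (hf : ∀ v, ∃ N : ℤ, ∀ n, N ≤ n → f n v = 0) : VertexOperator ℂ Fock :=
  VertexOperator.of_coeff (fun k => f (-k - 1)) (by
    intro v
    obtain ⟨N, hN⟩ := hf v
    refine ⟨-N, fun k hk => ?_⟩
    by_contra hlt
    exact hk (hN _ (by omega)))

@[simp]
theorem fieldOfModes_mode (f : ℤ → Module.End ℂ Fock)
    (hf : ∀ v, ∃ N : ℤ, ∀ n, N ≤ n → f n v = 0) (n : ℤ) :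
    (fieldOfModes f hf)[[n]] = f n := by
  rw [fieldOfModes, VertexOperator.ncoeff_of_coeff]
  congr 1
  ring

theorem heis_vanish (v : Fock) : ∃ N : ℤ, ∀ n, N ≤ n → heis n v = 0 := by
  classical
  refine ⟨((v.vars.sup fun i : ℕ+ => (i : ℕ)) + 1 : ℕ), fun n hn => ?_⟩
  obtain ⟨k, rfl⟩ : ∃ k : ℕ, n = Int.ofNat (k + 1) := by
    refine ⟨(n - 1).toNat, ?_⟩
    simp only [Int.ofNat_eq_natCast]
    omega
  have hk : k.succPNat ∉ v.vars := by
    intro hmem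
    have h1 := Finset.le_sup (f := fun i : ℕ+ => (i : ℕ)) hmem
    simp only [Nat.succPNat_coe, Int.ofNat_eq_natCast] at h1 hn
    omega
  simp [heis, MvPolynomial.pderiv_eq_zero_of_notMem_vars hk]

/-- The Heisenberg field `α(z) = ∑ α_n z^{-n-1}`. -/
noncomputable def heisField : VertexOperator ℂ Fock :=
  fieldOfModes heis heis_vanish

/-- The identity field `I(z)`, whose only non-zero mode is `I_{-1} = id`. -/
noncomputable def identityField : VertexOperator ℂ Fock :=
  fieldOfModes (fun n => if n = -1 then LinearMap.id else 0)
    (fun v => ⟨0, fun n hn => by rw [if_neg (by omega)]; rfl⟩)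

/-- The divided derivative `∂^{(k)} A(z) = (1/k!) ∂^k A(z)`. Since
`∂^{(k)} z^{-n+k-1} = (-1)^k (n choose k) z^{-n-1}`, its `n`-th mode is
`(-1)^k (n choose k) A_{n-k}`. -/
noncomputable def dividedDeriv (k : ℕ) (A : VertexOperator ℂ Fock) : VertexOperator ℂ Fock :=
  fieldOfModes (fun n => ((-1) ^ k * Ring.choose n k : ℤ) • A[[n - k]]) (by
    intro v
    obtain ⟨N, hN⟩ := field_modes_vanish A v
    refine ⟨N + k, fun n hn => ?_⟩
    rw [LinearMap.smul_apply, hN _ (by omega), smul_zero])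

/-- The `j`-th term of the `n`-th mode of the normally ordered product applied to `v`:
`A_j B_{n-1-j} v` if `j < 0`, and `B_{n-1-j} A_j v` if `j ≥ 0`. -/
noncomputable def normalOrderTerm (A B : VertexOperator ℂ Fock) (n j : ℤ) : Module.End ℂ Fock :=
  if j < 0 then A[[j]] * B[[n - 1 - j]] else B[[n - 1 - j]] * A[[j]]

theorem normalOrderTerm_finite (A B : VertexOperator ℂ Fock) (n : ℤ) (v : Fock) :
    (Function.support fun j => normalOrderTerm A B n j v).Finite := by
  obtain ⟨M, hM⟩ := field_modes_vanish A v
  obtain ⟨N, hN⟩ := field_modes_vanish B v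
  refine (Set.finite_Ioo (min (n - 1 - N) (-1)) (max M 0)).subset fun j hj => ?_
  rw [Function.mem_support] at hj
  by_cases h : j < 0
  · simp only [normalOrderTerm, if_pos h, Module.End.mul_apply] at hj
    have hjN : n - 1 - N < j := by
      by_contra hle
      exact hj (by rw [hN _ (by omega), map_zero])
    exact ⟨lt_of_le_of_lt (min_le_left _ _) hjN, lt_of_lt_of_le h (le_max_right _ _)⟩
  · simp only [normalOrderTerm, if_neg h, Module.End.mul_apply] at hj
    have hjM : j < M := by
      by_contra hle
      exact hj (by rw [hM _ (by omega), map_zero])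
    exact ⟨lt_of_le_of_lt (min_le_right _ _) (by omega), lt_of_lt_of_le hjM (le_max_left _ _)⟩

/-- The `n`-th mode of the normally ordered product `:A(z)B(z): = A(z)_- B(z) + B(z) A(z)_+`,
where `A(z)_+` is the part with modes `A_j`, `j ≥ 0`, and `A(z)_-` the part with modes `A_j`,
`j < 0`. The sum is finite on every vector. -/
noncomputable def normalOrderMode (A B : VertexOperator ℂ Fock) (n : ℤ) : Module.End ℂ Fock where
  toFun v := ∑ᶠ j : ℤ, normalOrderTerm A B n j v
  map_add' u v := by
    simp only [map_add]
    exact finsum_add_distrib (normalOrderTerm_finite A B n u) (normalOrderTerm_finite A B n v)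
  map_smul' c v := by
    simp only [map_smul, RingHom.id_apply]
    exact (smul_finsum c _).symm

theorem normalOrderMode_vanish (A B : VertexOperator ℂ Fock) (v : Fock) :
    ∃ N : ℤ, ∀ n, N ≤ n → normalOrderMode A B n v = 0 := by
  obtain ⟨M, hM⟩ := field_modes_vanish A v
  obtain ⟨N, hN⟩ := field_modes_vanish B v
  choose K hK using fun j : ℤ => field_modes_vanish B ((A[[j]]) v)
  obtain ⟨L, hL⟩ := ((Set.finite_Ico (0 : ℤ) M).image fun j => K j + j + 1).bddAbove
  refine ⟨max N L, fun n hn => ?_⟩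
  have hnN : N ≤ n := le_trans (le_max_left _ _) hn
  have hnL : L ≤ n := le_trans (le_max_right _ _) hn
  refine (finsum_congr fun j => ?_).trans finsum_zero
  by_cases h : j < 0
  · simp only [normalOrderTerm, if_pos h, Module.End.mul_apply]
    rw [hN _ (by omega), map_zero]
  · simp only [normalOrderTerm, if_neg h, Module.End.mul_apply]
    by_cases hj : j < M
    · have h1 : K j + j + 1 ≤ L := hL ⟨j, ⟨by omega, hj⟩, rfl⟩
      exact hK j _ (by omega)
    · rw [hM _ (by omega), map_zero]

/-- The normally ordered product `:A(z)B(z):` of two fields. -/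
noncomputable def normalOrder (A B : VertexOperator ℂ Fock) : VertexOperator ℂ Fock :=
  fieldOfModes (normalOrderMode A B) (normalOrderMode_vanish A B)

/-- The field of the monomial `x_{i₁} ⋯ x_{iₖ}` with `i₁ ≤ ⋯ ≤ iₖ`: the nested normally ordered
product `:∂^{(i₁-1)}α(z) ⋯ ∂^{(iₖ-1)}α(z):`, which is the identity field for `k = 0`. -/
noncomputable def monomialField (m : ℕ+ →₀ ℕ) : VertexOperator ℂ Fock :=
  ((Finsupp.toMultiset m).sort (· ≤ ·)).foldr
    (fun i F => normalOrder (dividedDeriv ((i : ℕ) - 1) heisField) F) identityField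

/-- The state-field correspondence `a ↦ Y(a, z)` of the free bosonic vertex algebra, the linear
map given on monomials by `monomialField`. The vacuum vector is `1`. -/
noncomputable def stateField : Fock →ₗ[ℂ] VertexOperator ℂ Fock :=
  (MvPolynomial.basisMonomials ℕ+ ℂ).constr ℂ monomialField

/-- The operator `a_{(n)}` of the free bosonic vertex algebra; its products are
`a_{(n)} b = mode a n b`. -/
noncomputable def mode (a : Fock) (n : ℤ) : Module.End ℂ Fock := (stateField a)[[n]]

/-- The translation `T a = a_{(-2)} 1`. -/
noncomputable def translation : Module.End ℂ Fock where
  toFun a := mode a (-2) 1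
  map_add' a b := by simp [mode]
  map_smul' c a := by simp [mode]

/-- A Virasoro vector (of some central charge `c`): a non-zero vector `v` with `v_{(n)} v = 0` for
`n ≥ 4`, `v_{(3)} v = (c/2) 1`, `v_{(2)} v = 0`, `v_{(1)} v = 2 v` and `v_{(0)} v = T v`. -/
def IsVirasoroVector (v : Fock) : Prop :=
  v ≠ 0 ∧ (∀ n : ℤ, 4 ≤ n → mode v n v = 0) ∧
    (∃ c : ℂ, mode v 3 v = MvPolynomial.C (c / 2)) ∧
    mode v 2 v = 0 ∧ mode v 1 v = (2 : ℂ) • v ∧ mode v 0 v = translation v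

/-- A conformal vector: a Virasoro vector `v` such that `L_0 = v_{(1)}` is semisimple and
`L_{-1} = v_{(0)}` is the translation. -/
def IsConformalVector (v : Fock) : Prop :=
  IsVirasoroVector v ∧ (mode v 1).IsSemisimple ∧ mode v 0 = translation

/-- The automorphism group of the free bosonic vertex algebra: the linear bijections that preserve
all the products. -/
noncomputable def vertexAut : Subgroup (Fock ≃ₗ[ℂ] Fock) where
  carrier := {σ | ∀ (n : ℤ) (a b : Fock), σ (mode a n b) = mode (σ a) n (σ b)}
  mul_mem' := by
    intro σ τ hσ hτ n a b
    rw [LinearEquiv.mul_apply, hτ, hσ]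
    rfl
  one_mem' := fun _ _ _ => rfl
  inv_mem' := by
    intro σ hσ n a b
    apply σ.injective
    have h : ∀ x, σ (σ⁻¹ x) = x := fun x => σ.apply_symm_apply x
    rw [h, hσ, h, h]

/-- `D` is an inner derivation of level `m`: `D = a_{(m)}` for some `a` with
`a_{(0)} = ⋯ = a_{(m-1)} = 0`, and `D` is a derivation for all the products. -/
def IsInnerDerivation (m : ℕ) (D : Module.End ℂ Fock) : Prop :=
  (∃ a : Fock, (∀ j : ℕ, j < m → mode a j = 0) ∧ D = mode a m) ∧
    ∀ (n : ℤ) (b c : Fock), D (mode b n c) = mode (D b) n c + mode b n (D c)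

/-- `σ = exp D`: on every vector `v` the exponential series `∑ Dᵏ v / k!` converges to `σ v`, tested
against all linear functionals. (Such a series converges exactly when the vectors `Dᵏ v` span a
finite-dimensional space, and convergence is then the usual one in that space.) -/
def IsExp (D : Module.End ℂ Fock) (σ : Fock ≃ₗ[ℂ] Fock) : Prop :=
  ∀ (v : Fock) (f : Module.Dual ℂ Fock),
    HasSum (fun k : ℕ => (k.factorial : ℂ)⁻¹ * f ((D ^ k) v)) (f (σ v))

/-- `σ` is an automorphism that is the exponential of an inner derivation of level `m`. -/
def IsExpInner (m : ℕ) (σ : Fock ≃ₗ[ℂ] Fock) : Prop :=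
  σ ∈ vertexAut ∧ ∃ D, IsInnerDerivation m D ∧ IsExp D σ

/-- The group `Inn_(m)` of inner automorphisms of level `m`, generated by the exponentials of inner
derivations of level `m`. -/
noncomputable def innerAutLevel (m : ℕ) : Subgroup (Fock ≃ₗ[ℂ] Fock) :=
  Subgroup.closure {σ | IsExpInner m σ}

/-- The group `Inn` of all inner automorphisms. -/
noncomputable def innerAut : Subgroup (Fock ≃ₗ[ℂ] Fock) :=
  ⨆ m : ℕ, innerAutLevel m

/-- The vector `½ x₁² + l x₂`. -/
noncomputable def standardVector (l : ℂ) : Fock :=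
  (1 / 2 : ℂ) • MvPolynomial.X 1 ^ 2 + l • MvPolynomial.X 2

/-! Products are computed by contraction. A mode of the field of `x_i` with negative index
multiplies by a variable, and one with index `≥ 0` is a multiple of a derivative. Filter `Fock` by
the number of variables, every `x_i` counted once. For `n ≥ 0` a product `a_{(n)} c` contains at
least one contraction, so the degree drops by at least two. If only `x_1, …, x_r` occur, the leading
part of `a_{(2r-1)} c` is a non-zero multiple of `∂_r a · ∂_r c` (`mode_top`).

For a Virasoro vector `v`, this applied to the top component, with `r` its highest index, forces `r
= 1`, degree two and the quadratic part `½ x_1²` (`sub_half_sq_mem_degLE`). The constant terms of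
`v_{(2s-1)} v` then remove the linear terms in `x_s` for `s > 2` and fix the constant term, leaving
`½(x_1 + μ)² + l x_2` (`IsVirasoroVector.eq_standardVector`). The translation `x_1 ↦ x_1 - μ`, the
exponential of `-μ ∂/∂x_1`, is an inner automorphism and removes `μ`.

For uniqueness, `l` must be unchanged by inner automorphisms. The same leading term argument shows
that an automorphism sends `x_1` to `ε x_1 + c`. Setting `x_2 = x_3 = ⋯ = 0` kills all products of
index below `-1` and turns `a_{(-1)}` into multiplication. A derivation applied to `x_1_{(1)} x_1 =
1` therefore sends `x_1` to a constant modulo these variables, so its exponential has `ε = 1`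
(`exp_map_X_one`). Since `x_1` generates the algebra, such an automorphism fixes `x_2` and keeps `l`
(`translationAut_standardVector`). -/

open MvPolynomial

/-! ### Modes of the generators -/

/-- The modes of the divided derivative `∂^{(i-1)} α(z)`, the field of `x_i`. -/
noncomputable def varMode (i : ℕ+) (j : ℤ) : Module.End ℂ Fock :=
  (dividedDeriv ((i : ℕ) - 1) heisField)[[j]]

theorem varMode_eq (i : ℕ+) (j : ℤ) :
    varMode i j = (((-1) ^ ((i : ℕ) - 1) * Ring.choose j ((i : ℕ) - 1) : ℤ) : ℂ) •
      heis (j + 1 - i) := by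
  have h : j - (((i : ℕ) - 1 : ℕ) : ℤ) = j + 1 - i := by
    have := i.pos
    omega
  rw [varMode, dividedDeriv, fieldOfModes_mode, heisField, fieldOfModes_mode, h]
  exact (Int.cast_smul_eq_zsmul ℂ _ _).symm

theorem heis_zero : heis 0 = 0 := rfl

theorem heis_coe (t : ℕ+) : heis (t : ℕ) = ((t : ℕ) : ℂ) • (pderiv t).toLinearMap := by
  obtain ⟨n, rfl⟩ : ∃ n : ℕ, t = n.succPNat := ⟨t.natPred, by simp⟩
  rfl

theorem heis_neg_coe (t : ℕ+) : heis (-(t : ℕ)) = LinearMap.mulLeft ℂ (X t) := by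
  obtain ⟨n, rfl⟩ : ∃ n : ℕ, t = n.succPNat := ⟨t.natPred, by simp⟩
  rfl

theorem heis_coe_apply (t : ℕ+) (c : Fock) : heis (t : ℕ) c = ((t : ℕ) : ℂ) • pderiv t c := by
  rw [heis_coe]
  rfl

theorem heis_neg_coe_apply (t : ℕ+) (c : Fock) : heis (-(t : ℕ)) c = X t * c := by
  rw [heis_neg_coe]
  rfl

theorem varMode_neg_one (i : ℕ+) (c : Fock) : varMode i (-1) c = X i * c := by
  have h : (-1 : ℤ) + 1 - i = -(i : ℕ) := by simp
  rw [varMode_eq, h, LinearMap.smul_apply, heis_neg_coe_apply]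
  -- With `k = i - 1`, the binomial coefficient of `-1` over `k` is `(-1)^k`, which cancels the
  -- sign.
  have : ((-1) ^ ((i : ℕ) - 1) * Ring.choose (-1 : ℤ) ((i : ℕ) - 1) : ℤ) = 1 := by
    obtain ⟨k, hk⟩ : ∃ k : ℕ, k = (i : ℕ) - 1 := ⟨_, rfl⟩
    rw [← hk, Ring.choose_neg, Int.negOnePow_def]
    have h1 : (1 : ℤ) + k - 1 = (k : ℕ) := by ring
    rw [h1, Ring.choose_natCast, Nat.choose_self]
    simp [Units.smul_def, ← mul_pow]
  rw [this]
  simp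

/-- The bound `2 ≤ t` matters: below index `-1` the variable `x_1` is never created, so these modes
die in the reduction and commute with translations of `x_1`. -/
theorem varMode_of_lt (i : ℕ+) {j : ℤ} (hj : j < -1) :
    ∃ γ : ℂ, ∃ t : ℕ+, 2 ≤ t ∧ ∀ c, varMode i j c = γ • (X t * c) := by
  have hi := i.pos
  obtain ⟨t, ht⟩ : ∃ t : ℕ+, ((t : ℕ) : ℤ) = i - 1 - j :=
    ⟨⟨(i - 1 - j).toNat, by omega⟩, by simp; omega⟩
  refine ⟨(((-1) ^ ((i : ℕ) - 1) * Ring.choose j ((i : ℕ) - 1) : ℤ) : ℂ), t, ?_, fun c => ?_⟩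
  · rw [← PNat.coe_le_coe]
    change 2 ≤ (t : ℕ)
    omega
  · rw [varMode_eq, show j + 1 - i = -((t : ℕ) : ℤ) by omega, LinearMap.smul_apply,
      heis_neg_coe_apply]

theorem varMode_of_neg (i : ℕ+) {j : ℤ} (hj : j < 0) :
    ∃ γ : ℂ, ∃ t : ℕ+, ∀ c, varMode i j c = γ • (X t * c) := by
  rcases (show j ≤ -1 by omega).eq_or_lt with rfl | h
  · exact ⟨1, i, fun c => by rw [varMode_neg_one, one_smul]⟩
  · obtain ⟨γ, t, -, h⟩ := varMode_of_lt i h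
    exact ⟨γ, t, h⟩

/-- At `j = i - 1` the mode is a multiple of `α_0 = 0`; for smaller `j` the binomial coefficient
vanishes. -/
theorem varMode_of_lt_index (i : ℕ+) {j : ℤ} (h0 : 0 ≤ j) (hj : j < i) : varMode i j = 0 := by
  rcases (show j + 1 ≤ i by omega).eq_or_lt with h | h
  · rw [varMode_eq, show j + 1 - i = 0 by omega, heis_zero, smul_zero]
  · lift j to ℕ using h0
    rw [varMode_eq, Ring.choose_natCast, Nat.choose_eq_zero_of_lt (by omega)]
    simp

theorem varMode_add (i t : ℕ+) (c : Fock) :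
    varMode i ((i : ℕ) + (t : ℕ) - 1 : ℤ) c =
      ((-1) ^ ((i : ℕ) - 1) * ((i + t - 1 : ℕ).choose (i - 1)) * (t : ℕ) : ℂ) • pderiv t c := by
  have hi := i.pos
  have h : ((i : ℕ) + (t : ℕ) - 1 : ℤ) = ((i + t - 1 : ℕ) : ℤ) := by omega
  rw [varMode_eq, show ((i : ℕ) + (t : ℕ) - 1 : ℤ) + 1 - i = (t : ℕ) by omega,
    LinearMap.smul_apply, heis_coe_apply, h, Ring.choose_natCast, smul_smul]
  push_cast
  rfl

theorem varMode_of_nonneg (i : ℕ+) {j : ℤ} (h0 : 0 ≤ j) :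
    varMode i j = 0 ∨ ∃ t : ℕ+, j = i + t - 1 ∧
      ∃ γ : ℂ, ∀ c, varMode i j c = γ • pderiv t c := by
  by_cases h : j < i
  · exact .inl (varMode_of_lt_index i h0 h)
  · obtain ⟨t, rfl⟩ : ∃ t : ℕ+, j = (i : ℕ) + (t : ℕ) - 1 :=
      ⟨⟨(j + 1 - i).toNat, by omega⟩, by simp; omega⟩
    exact .inr ⟨t, rfl, _, varMode_add i t⟩

/-! ### Fields of monomials, one variable at a time -/

theorem stateField_monomial (m : ℕ+ →₀ ℕ) : stateField (monomial m 1) = monomialField m := by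
  have := (basisMonomials ℕ+ ℂ).constr_basis ℂ monomialField m
  rwa [coe_basisMonomials] at this

theorem stateField_one : stateField 1 = identityField := by
  have h : (1 : Fock) = monomial 0 1 := rfl
  rw [h, stateField_monomial, monomialField, map_zero, Multiset.sort_zero]
  rfl

/-- The normally ordered product is nested in increasing order of the indices, so only a variable of
lowest index can be split off. Hence the sorted inductions below. -/
theorem stateField_X_mul (i : ℕ+) (m : ℕ+ →₀ ℕ) (h : ∀ j ∈ m.support, i ≤ j) :
    stateField (X i * monomial m 1) =
      normalOrder (dividedDeriv ((i : ℕ) - 1) heisField) (stateField (monomial m 1)) := by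
  have hs : (i ::ₘ Finsupp.toMultiset m).sort (· ≤ ·) = i :: (Finsupp.toMultiset m).sort (· ≤ ·) :=
    Multiset.sort_cons _ _ _ (by simpa using h)
  rw [X, monomial_mul, one_mul, stateField_monomial, stateField_monomial, monomialField,
    Finsupp.toMultiset_add, Finsupp.toMultiset_single, one_smul, Multiset.singleton_add, hs]
  rfl

/-- Induction on monomials, one variable at a time in decreasing order. -/
theorem monomial_sorted_induction {P : (ℕ+ →₀ ℕ) → Prop} (h0 : P 0)
    (hX : ∀ (i : ℕ+) (m : ℕ+ →₀ ℕ), (∀ j ∈ m.support, i ≤ j) → P m →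
      P (Finsupp.single i 1 + m)) (m : ℕ+ →₀ ℕ) : P m := by
  classical
  induction hn : m.degree generalizing m with
  | zero => 
    rw [Finsupp.degree_eq_zero_iff] at hn
    rwa [hn]
  | succ n ih =>
    have hm : m.support.Nonempty := by
      rw [Finsupp.support_nonempty_iff]
      rintro rfl
      simp at hn
    have hle : Finsupp.single (m.support.min' hm) 1 ≤ m := by
      rw [Finsupp.single_le_iff, Nat.one_le_iff_ne_zero]
      exact Finsupp.mem_support_iff.mp (m.support.min'_mem hm)
    have hadd : Finsupp.single (m.support.min' hm) 1 + (m - Finsupp.single (m.support.min' hm) 1)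
        = m := add_tsub_cancel_of_le hle
    rw [← hadd]
    refine hX _ _ (fun j hj => ?_) (ih _ ?_)
    · exact m.support.min'_le j (Finsupp.support_tsub hj)
    · have := congrArg Finsupp.degree hadd
      rw [map_add, Finsupp.degree_single] at this
      omega

/-- The `j`-th term of the `n`-th mode of `:Y(x_i, z) Y(p, z):` applied to `c`. -/
noncomputable def normalOrderVarTerm (i : ℕ+) (p : Fock) (n : ℤ) (c : Fock) (j : ℤ) : Fock :=
  if j < 0 then varMode i j (mode p (n - 1 - j) c) else mode p (n - 1 - j) (varMode i j c)

/-- The modes of `x_i b` when `Y(x_i b, z)` is the normally ordered product of the fields. -/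
theorem mode_X_mul (i : ℕ+) (m : ℕ+ →₀ ℕ) (h : ∀ j ∈ m.support, i ≤ j) (n : ℤ) (c : Fock) :
    mode (X i * monomial m 1) n c =
      ∑ᶠ j, normalOrderVarTerm i (monomial m 1) n c j := by
  rw [mode, stateField_X_mul i m h, normalOrder, fieldOfModes_mode]
  refine finsum_congr fun j => ?_
  unfold normalOrderVarTerm
  split_ifs with hj
  · rw [normalOrderTerm, if_pos hj]
    rfl
  · rw [normalOrderTerm, if_neg hj]
    rfl

theorem mode_X_mul_finite (i : ℕ+) (b : Fock) (n : ℤ) (c : Fock) :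
    (Function.support (normalOrderVarTerm i b n c)).Finite := by
  convert normalOrderTerm_finite (dividedDeriv ((i : ℕ) - 1) heisField) (stateField b) n c using 2
  funext j
  unfold normalOrderVarTerm
  split_ifs with hj
  · rw [normalOrderTerm, if_pos hj]
    rfl
  · rw [normalOrderTerm, if_neg hj]
    rfl

/-- Allows the mode sums to be computed modulo a submodule, later a step of the degree filtration or
the kernel of a linear map, keeping only the few relevant indices. -/
theorem finsum_sub_sum_mem {M : Type*} [AddCommGroup M] [Module ℂ M] (S : Submodule ℂ M)
    {f : ℤ → M} (hf : f.support.Finite) (s : Finset ℤ) (h : ∀ j ∉ s, f j ∈ S) :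
    ∑ᶠ j, f j - ∑ j ∈ s, f j ∈ S := by
  classical
  rw [finsum_eq_sum_of_support_subset f (s := hf.toFinset ∪ s) (by
    intro j hj
    simp [Function.mem_support.mp hj]), ← Finset.sum_sdiff Finset.subset_union_right,
    add_sub_cancel_right]
  exact S.sum_mem fun j hj => h j (Finset.mem_sdiff.mp hj).2

/-- The summand `j = -1` is plain multiplication by `x_i`; all the others are negligible modulo `S`.
-/
theorem mode_X_mul_mem (S : Submodule ℂ Fock) (i : ℕ+) (m : ℕ+ →₀ ℕ)
    (h : ∀ j ∈ m.support, i ≤ j) (n : ℤ) (c : Fock)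
    (hneg : ∀ j < -1, varMode i j (mode (monomial m 1) (n - 1 - j) c) ∈ S)
    (hpos : ∀ j, 0 ≤ j → mode (monomial m 1) (n - 1 - j) (varMode i j c) ∈ S) :
    mode (X i * monomial m 1) n c - X i * mode (monomial m 1) n c ∈ S := by
  have := finsum_sub_sum_mem S (mode_X_mul_finite i (monomial m 1) n c) {-1} (fun j hj => by
    have hj' : j ≠ -1 := by simpa using hj
    unfold normalOrderVarTerm
    split_ifs with h
    · exact hneg j (by omega)
    · exact hpos j (by omega))
  rwa [← mode_X_mul i m h, Finset.sum_singleton, normalOrderVarTerm,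
    if_pos (by norm_num), varMode_neg_one, show n - 1 - -1 = n by ring] at this

/-- Variant in which one contraction, at `j = k`, also survives modulo `S`. -/
theorem mode_X_mul_mem_of_two (S : Submodule ℂ Fock) (i : ℕ+) (m : ℕ+ →₀ ℕ)
    (h : ∀ j ∈ m.support, i ≤ j) (n : ℤ) (c : Fock) (k : ℤ) (hk : 0 ≤ k)
    (hneg : ∀ j < -1, varMode i j (mode (monomial m 1) (n - 1 - j) c) ∈ S)
    (hpos : ∀ j, 0 ≤ j → j ≠ k → mode (monomial m 1) (n - 1 - j) (varMode i j c) ∈ S) :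
    mode (X i * monomial m 1) n c - (X i * mode (monomial m 1) n c +
      mode (monomial m 1) (n - 1 - k) (varMode i k c)) ∈ S := by
  have := finsum_sub_sum_mem S (mode_X_mul_finite i (monomial m 1) n c) {-1, k} (fun j hj => by
    simp only [Finset.mem_insert, Finset.mem_singleton, not_or] at hj
    unfold normalOrderVarTerm
    split_ifs with h
    · exact hneg j (by omega)
    · exact hpos j (by omega) hj.2)
  rwa [← mode_X_mul i m h, Finset.sum_pair (by omega), normalOrderVarTerm, normalOrderVarTerm,
    if_pos (by norm_num), if_neg (by omega), varMode_neg_one, show n - 1 - -1 = n by ring] at this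

/-! ### Linearity in the state and the vacuum -/

theorem mode_add (a b : Fock) (n : ℤ) : mode (a + b) n = mode a n + mode b n := by simp [mode]

theorem mode_sub (a b : Fock) (n : ℤ) : mode (a - b) n = mode a n - mode b n := by simp [mode]

theorem mode_smul (t : ℂ) (a : Fock) (n : ℤ) : mode (t • a) n = t • mode a n := by simp [mode]

theorem mode_one (n : ℤ) : mode 1 n = if n = -1 then 1 else 0 := by
  rw [mode, stateField_one, identityField, fieldOfModes_mode]
  rfl

theorem mode_one_of_ne {n : ℤ} (h : n ≠ -1) (c : Fock) : mode 1 n c = 0 := by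
  rw [mode_one, if_neg h, LinearMap.zero_apply]

theorem mode_one_neg_one (c : Fock) : mode 1 (-1) c = c := by
  rw [mode_one, if_pos rfl, Module.End.one_apply]

/-- The map `a ↦ a_{(n)} c`. -/
noncomputable def modeLeft (n : ℤ) (c : Fock) : Fock →ₗ[ℂ] Fock where
  toFun a := mode a n c
  map_add' a b := by rw [mode_add, LinearMap.add_apply]
  map_smul' t a := by rw [mode_smul, LinearMap.smul_apply, RingHom.id_apply]

theorem modeLeft_apply (n : ℤ) (a c : Fock) : modeLeft n c a = mode a n c := rfl

theorem X_mul_monomial (i : ℕ+) (m : ℕ+ →₀ ℕ) :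
    (X i * monomial m 1 : Fock) = monomial (Finsupp.single i 1 + m) 1 := by
  rw [X, monomial_mul, one_mul]

theorem linearMap_ext_sorted {M : Type*} [AddCommGroup M] [Module ℂ M] {f g : Fock →ₗ[ℂ] M}
    (h1 : f 1 = g 1)
    (hX : ∀ (i : ℕ+) (m : ℕ+ →₀ ℕ), (∀ j ∈ m.support, i ≤ j) →
      f (monomial m 1) = g (monomial m 1) → f (X i * monomial m 1) = g (X i * monomial m 1)) :
    f = g := by
  refine (basisMonomials ℕ+ ℂ).ext fun m => ?_
  rw [coe_basisMonomials]
  induction m using monomial_sorted_induction with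
  | h0 => exact h1
  | hX i m hm ih =>
    dsimp only
    rw [← X_mul_monomial]
    exact hX i m hm ih

theorem mode_X (i : ℕ+) (n : ℤ) : mode (X i) n = varMode i n := by
  refine LinearMap.ext fun c => ?_
  have h := mode_X_mul i 0 (by simp) n c
  have h1 : (monomial (0 : ℕ+ →₀ ℕ) (1 : ℂ)) = 1 := rfl
  rw [h1, mul_one] at h
  rw [h, finsum_eq_single _ n]
  · rw [normalOrderVarTerm, show n - 1 - n = -1 by ring, mode_one_neg_one,
      mode_one_neg_one, ite_self]
  · intro j hj
    rw [normalOrderVarTerm, mode_one_of_ne (by omega), mode_one_of_ne (by omega), map_zero,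
      ite_self]

theorem varMode_apply_one (i : ℕ+) {j : ℤ} (h0 : 0 ≤ j) : varMode i j 1 = 0 := by
  rcases varMode_of_nonneg i h0 with h | ⟨t, -, γ, h⟩
  · rw [h, LinearMap.zero_apply]
  · rw [h, pderiv_one, smul_zero]

theorem vacuum_monomial (m : ℕ+ →₀ ℕ) : (∀ n : ℤ, 0 ≤ n → mode (monomial m 1) n 1 = 0) ∧
    mode (monomial m 1) (-1) 1 = monomial m 1 := by
  induction m using monomial_sorted_induction with
  | h0 => exact ⟨fun n hn => mode_one_of_ne (by omega) 1, mode_one_neg_one 1⟩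
  | hX i m hm ih =>
    have key : ∀ n : ℤ, -1 ≤ n →
        mode (X i * monomial m 1) n 1 = X i * mode (monomial m 1) n 1 := by
      intro n hn
      rw [← sub_eq_zero, ← Submodule.mem_bot ℂ]
      refine mode_X_mul_mem ⊥ i m hm n 1 (fun j hj => ?_) (fun j hj => ?_)
      · rw [ih.1 _ (by omega), map_zero, Submodule.mem_bot]
      · rw [varMode_apply_one i hj, map_zero, Submodule.mem_bot]
    rw [← X_mul_monomial]
    refine ⟨fun n hn => ?_, ?_⟩
    · rw [key n (by omega), ih.1 n hn, mul_zero]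
    · rw [key _ le_rfl, ih.2]

/-- A linear subspace contains the images of all polynomials with support in `s` as soon as it
contains those of the monomials. -/
theorem map_mem_of_support {M : Type*} [AddCommGroup M] [Module ℂ M] (f : Fock →ₗ[ℂ] M)
    (S : Submodule ℂ M) (a : Fock) (h : ∀ m ∈ a.support, f (monomial m 1) ∈ S) : f a ∈ S := by
  rw [a.as_sum, map_sum]
  refine S.sum_mem fun m hm => ?_
  have : monomial m (coeff m a) = coeff m a • (monomial m 1 : Fock) := by
    rw [smul_monomial, smul_eq_mul, mul_one]
  rw [this, map_smul]
  exact S.smul_mem _ (h m hm)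

/-- The creation axiom: `a_{(-1)} 1 = a`. -/
theorem mode_neg_one_apply_one (a : Fock) : mode a (-1) 1 = a := by
  refine sub_eq_zero.mp ((Submodule.mem_bot ℂ).mp
    (map_mem_of_support (modeLeft (-1) 1 - LinearMap.id) ⊥ a fun m _ => ?_))
  rw [Submodule.mem_bot, LinearMap.sub_apply, sub_eq_zero]
  exact (vacuum_monomial m).2

/-! ### The degree filtration -/

/-- The polynomials of total degree at most `k`, for an integer `k`. -/
noncomputable def degLE (k : ℤ) : Submodule ℂ Fock := restrictSupport ℂ {m | (m.degree : ℤ) ≤ k}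

theorem mem_degLE {k : ℤ} {p : Fock} :
    p ∈ degLE k ↔ ∀ m ∈ p.support, (m.degree : ℤ) ≤ k := by
  rw [degLE, mem_restrictSupport_iff]
  rfl

theorem degLE_mono {k l : ℤ} (h : k ≤ l) : degLE k ≤ degLE l :=
  restrictSupport_mono _ fun _ hm => le_trans (show ((Finsupp.degree _ : ℕ) : ℤ) ≤ k from hm) h

theorem monomial_mem_degLE {k : ℤ} {m : ℕ+ →₀ ℕ} (h : (m.degree : ℤ) ≤ k) (t : ℂ) :
    monomial m t ∈ degLE k :=
  (monomial_mem_restrictSupport ..).mpr (.inl h)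

theorem one_mem_degLE : (1 : Fock) ∈ degLE 0 :=
  monomial_mem_degLE (m := 0) (by simp) 1

theorem C_mem_degLE (t : ℂ) : (C t : Fock) ∈ degLE 0 :=
  monomial_mem_degLE (m := 0) (by simp) t

theorem X_mem_degLE (i : ℕ+) : (X i : Fock) ∈ degLE 1 :=
  monomial_mem_degLE (by rw [Finsupp.degree_single]; rfl) 1

theorem mul_mem_degLE {k l : ℤ} {p q : Fock} (hp : p ∈ degLE k) (hq : q ∈ degLE l) :
    p * q ∈ degLE (k + l) := by
  classical
  rw [mem_degLE] at *
  intro m hm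
  obtain ⟨a, ha, b, hb, rfl⟩ := Finset.mem_add.mp (support_mul p q hm)
  have := hp a ha
  have := hq b hb
  rw [map_add]
  push_cast
  omega

theorem X_mul_mem_degLE {k : ℤ} (i : ℕ+) {p : Fock} (hp : p ∈ degLE k) :
    X i * p ∈ degLE (k + 1) :=
  add_comm 1 k ▸ mul_mem_degLE (X_mem_degLE i) hp

theorem pderiv_mem_degLE {k : ℤ} (i : ℕ+) {p : Fock} (hp : p ∈ degLE k) :
    pderiv i p ∈ degLE (k - 1) := by
  refine map_mem_of_support (pderiv i).toLinearMap _ p fun m hm => ?_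
  have hk := mem_degLE.mp hp m hm
  change pderiv i (monomial m 1) ∈ _
  rw [pderiv_monomial]
  by_cases h : m i = 0
  · rw [h, Nat.cast_zero, mul_zero, monomial_zero]
    exact zero_mem _
  · refine monomial_mem_degLE ?_ _
    have hle : Finsupp.single i 1 ≤ m := by
      rw [Finsupp.single_le_iff]
      omega
    have := congrArg Finsupp.degree (tsub_add_cancel_of_le hle)
    rw [map_add, Finsupp.degree_single] at this
    omega

theorem varMode_mem_degLE_of_neg {k l : ℤ} (i : ℕ+) {j : ℤ} (hj : j < 0) {p : Fock}
    (hp : p ∈ degLE k) (h : k + 1 ≤ l) : varMode i j p ∈ degLE l := by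
  obtain ⟨γ, t, ht⟩ := varMode_of_neg i hj
  rw [ht]
  exact Submodule.smul_mem _ _ (degLE_mono h (X_mul_mem_degLE t hp))

theorem varMode_mem_degLE_of_nonneg {k : ℤ} (i : ℕ+) {j : ℤ} (hj : 0 ≤ j) {p : Fock}
    (hp : p ∈ degLE k) : varMode i j p ∈ degLE (k - 1) := by
  rcases varMode_of_nonneg i hj with h | ⟨t, -, γ, h⟩
  · rw [h, LinearMap.zero_apply]
    exact zero_mem _
  · rw [h]
    exact Submodule.smul_mem _ _ (pderiv_mem_degLE t hp)

theorem degree_single_add (i : ℕ+) (m : ℕ+ →₀ ℕ) :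
    (((Finsupp.single i 1 + m).degree : ℕ) : ℤ) = m.degree + 1 := by
  rw [map_add, Finsupp.degree_single]
  push_cast
  ring

theorem of_sub_mem {S : Submodule ℂ Fock} {p q : Fock} (h : p - q ∈ S) (hq : q ∈ S) : p ∈ S := by
  simpa using S.add_mem h hq

/-- A summand with `j ≥ 0` contracts `x_i` with a variable of `c`, which costs two degrees. A
summand with `j < 0` leaves the index `n - 1 - j ≥ n` to the other factors, so for `n ≥ 0` the
contraction comes from the induction hypothesis. -/
theorem mode_monomial_mem_degLE (m : ℕ+ →₀ ℕ) : ∀ (l : ℤ) (c : Fock), c ∈ degLE l → ∀ n : ℤ,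
    mode (monomial m 1) n c ∈ degLE (m.degree + l) ∧
      (0 ≤ n → mode (monomial m 1) n c ∈ degLE (m.degree + l - 2)) := by
  induction m using monomial_sorted_induction with
  | h0 =>
    intro l c hc n
    have h1 : (monomial (0 : ℕ+ →₀ ℕ) (1 : ℂ)) = 1 := rfl
    rw [h1]
    by_cases h : n = -1
    · subst h
      rw [mode_one_neg_one]
      exact ⟨by simpa using hc, fun h => by omega⟩
    · rw [mode_one_of_ne h]
      exact ⟨zero_mem _, fun _ => zero_mem _⟩
  | hX i m hm ih =>
    intro l c hc n
    rw [← X_mul_monomial, degree_single_add]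
    constructor
    · refine of_sub_mem (mode_X_mul_mem _ i m hm n c (fun j hj => ?_) (fun j hj => ?_))
        (degLE_mono ?_ (X_mul_mem_degLE i (ih l c hc n).1))
      · exact varMode_mem_degLE_of_neg i (by omega) (ih l c hc _).1 (by omega)
      · exact degLE_mono (by omega) (ih _ _ (varMode_mem_degLE_of_nonneg i hj hc) _).1
      · omega
    · intro hn
      refine of_sub_mem (mode_X_mul_mem _ i m hm n c (fun j hj => ?_) (fun j hj => ?_))
        (degLE_mono ?_ (X_mul_mem_degLE i ((ih l c hc n).2 hn)))
      · exact varMode_mem_degLE_of_neg i (by omega) ((ih l c hc _).2 (by omega)) (by omega)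
      · exact degLE_mono (by omega) (ih _ _ (varMode_mem_degLE_of_nonneg i hj hc) _).1
      · omega

theorem mode_mem_degLE {k l : ℤ} {a c : Fock} (ha : a ∈ degLE k) (hc : c ∈ degLE l) {n : ℤ}
    (hn : 0 ≤ n) : mode a n c ∈ degLE (k + l - 2) := by
  refine map_mem_of_support (modeLeft n c) _ a fun m hm => ?_
  exact degLE_mono (by linarith [mem_degLE.mp ha m hm])
    ((mode_monomial_mem_degLE m l c hc n).2 hn)

/-- At index `-1` the only summand without contraction is the ordinary product. -/
theorem mode_neg_one_sub_mul_mem_degLE (m : ℕ+ →₀ ℕ) : ∀ (l : ℤ) (c : Fock), c ∈ degLE l →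
    mode (monomial m 1) (-1) c - monomial m 1 * c ∈ degLE (m.degree + l - 2) := by
  induction m using monomial_sorted_induction with
  | h0 =>
    intro l c hc
    have h1 : (monomial (0 : ℕ+ →₀ ℕ) (1 : ℂ)) = 1 := rfl
    rw [h1, mode_one_neg_one, one_mul, sub_self]
    exact zero_mem _
  | hX i m hm ih =>
    intro l c hc
    rw [← X_mul_monomial, degree_single_add]
    have h := mode_X_mul_mem (degLE (m.degree + 1 + l - 2)) i m hm (-1) c (fun j hj =>
      varMode_mem_degLE_of_neg i (by omega)
        ((mode_monomial_mem_degLE m l c hc _).2 (by omega)) (by omega)) (fun j hj =>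
      degLE_mono (by omega)
        (mode_monomial_mem_degLE m _ _ (varMode_mem_degLE_of_nonneg i hj hc) _).1)
    have h2 : X i * (mode (monomial m 1) (-1) c - monomial m 1 * c) ∈
        degLE (m.degree + 1 + l - 2) :=
      degLE_mono (by omega) (X_mul_mem_degLE i (ih l c hc))
    convert add_mem h h2 using 1
    ring

/-! ### The leading pole of a product -/

/-- The coefficient of the pole of highest order of the operator product expansion of `x_r` with
itself. -/
noncomputable def poleCoeff (r : ℕ+) : ℂ :=
  (-1) ^ ((r : ℕ) - 1) * ((r + r - 1 : ℕ).choose (r - 1)) * (r : ℕ)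

theorem poleCoeff_ne_zero (r : ℕ+) : poleCoeff r ≠ 0 := by
  have h : (r + r - 1 : ℕ).choose (r - 1) ≠ 0 := by
    rw [Nat.choose_ne_zero_iff]
    omega
  simp [poleCoeff, h]

theorem poleCoeff_one : poleCoeff 1 = 1 := by simp [poleCoeff]

/-- The mode differentiates by `x_t` with `i + t = 2r`; as `i ≤ r`, this forces `t > r` unless `i =
t = r`. -/
theorem varMode_top {r i : ℕ+} (hi : i ≤ r) {c : Fock} (hc : ∀ t, r < t → pderiv t c = 0) :
    varMode i (2 * r - 1) c = if i = r then poleCoeff r • pderiv r c else 0 := by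
  split_ifs with h
  · subst h
    rw [show (2 * (i : ℕ) - 1 : ℤ) = (i : ℕ) + (i : ℕ) - 1 by ring, varMode_add]
    rfl
  · rcases varMode_of_nonneg i (j := 2 * r - 1) (by have := r.pos; omega) with h | ⟨t, ht, γ, hγ⟩
    · rw [h, LinearMap.zero_apply]
    · rw [hγ, hc t, smul_zero]
      rw [← PNat.coe_lt_coe]
      have h1 : (i : ℕ) < r := lt_of_le_of_ne hi (fun he => h (PNat.coe_injective he))
      omega

theorem varMode_zero_of_gt {r i : ℕ+} (hi : i ≤ r) {c : Fock} (hc : ∀ t, r < t → pderiv t c = 0)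
    {j : ℤ} (hj : 2 * r - 1 < j) : varMode i j c = 0 := by
  rcases varMode_of_nonneg i (j := j) (by have := r.pos; omega) with h | ⟨t, ht, γ, hγ⟩
  · rw [h, LinearMap.zero_apply]
  · rw [hγ, hc t, smul_zero]
    rw [← PNat.coe_lt_coe]
    have h1 : (i : ℕ) ≤ r := hi
    omega

/-- A contraction of variables of index at most `r` uses up an index `j ≤ 2r - 1`. The remaining
index `n - 1 - j` is still non-negative, so the other factors contract once more. -/
theorem mode_monomial_of_gt (r : ℕ+) (m : ℕ+ →₀ ℕ) : (∀ i ∈ m.support, i ≤ r) →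
    ∀ (l : ℤ) (c : Fock), c ∈ degLE l → (∀ t, r < t → pderiv t c = 0) → ∀ n : ℤ, 2 * r - 1 < n →
      mode (monomial m 1) n c ∈ degLE (m.degree + l - 3) := by
  induction m using monomial_sorted_induction with
  | h0 =>
    intro hr l c hc hcr n hn
    have h1 : (monomial (0 : ℕ+ →₀ ℕ) (1 : ℂ)) = 1 := rfl
    rw [h1, mode_one_of_ne (by omega)]
    exact zero_mem _
  | hX i m hm ih =>
    intro hr l c hc hcr n hn
    have hi : i ≤ r := hr i (by simp)
    have hr' : ∀ i ∈ m.support, i ≤ r := fun i hi => hr i (by simp at hi ⊢; omega)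
    rw [← X_mul_monomial, degree_single_add]
    refine of_sub_mem (mode_X_mul_mem _ i m hm n c (fun j hj => ?_) (fun j hj => ?_))
        (degLE_mono ?_ (X_mul_mem_degLE i (ih hr' l c hc hcr n hn)))
    · exact varMode_mem_degLE_of_neg i (by omega) (ih hr' l c hc hcr _ (by omega)) (by omega)
    · by_cases h : 2 * r - 1 < j
      · rw [varMode_zero_of_gt hi hcr h, map_zero]
        exact zero_mem _
      · exact degLE_mono (by omega)
          ((mode_monomial_mem_degLE m _ _ (varMode_mem_degLE_of_nonneg i hj hc) _).2 (by omega))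
    · omega

/-- Only the summand `j = 2r - 1` leaves the index `-1`, at which the other factors need not
contract. It is non-zero only for `i = r` and supplies the term `∂_r x_i` of the Leibniz rule; the
summand `j = -1` supplies the other term. -/
theorem mode_monomial_top (r : ℕ+) (m : ℕ+ →₀ ℕ) : (∀ i ∈ m.support, i ≤ r) →
    ∀ (l : ℤ) (c : Fock), c ∈ degLE l → (∀ t, r < t → pderiv t c = 0) →
      mode (monomial m 1) (2 * r - 1) c -
        poleCoeff r • (pderiv r (monomial m 1) * pderiv r c) ∈ degLE (m.degree + l - 3) := by
  have hr0 := r.pos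
  induction m using monomial_sorted_induction with
  | h0 =>
    intro hr l c hc hcr
    have h1 : (monomial (0 : ℕ+ →₀ ℕ) (1 : ℂ)) = 1 := rfl
    rw [h1, mode_one_of_ne (by omega), pderiv_one, zero_mul, smul_zero, sub_zero]
    exact zero_mem _
  | hX i m hm ih =>
    intro hr l c hc hcr
    have hi : i ≤ r := hr i (by simp)
    have hr' : ∀ i ∈ m.support, i ≤ r := fun i hi => hr i (by simp at hi ⊢; omega)
    rw [← X_mul_monomial, degree_single_add]
    have h := mode_X_mul_mem_of_two (degLE (m.degree + 1 + l - 3)) i m hm (2 * r - 1) c (2 * r - 1)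
      (by omega)
      (fun j hj => varMode_mem_degLE_of_neg i (by omega)
        (mode_monomial_of_gt r m hr' l c hc hcr _ (by omega)) (by omega))
      (fun j hj hne => by
        by_cases h : 2 * r - 1 < j
        · rw [varMode_zero_of_gt hi hcr h, map_zero]
          exact zero_mem _
        · exact degLE_mono (by omega) ((mode_monomial_mem_degLE m _ _
            (varMode_mem_degLE_of_nonneg i hj hc) _).2 (by omega)))
    have h2 : X i * (mode (monomial m 1) (2 * r - 1) c -
        poleCoeff r • (pderiv r (monomial m 1) * pderiv r c)) ∈ degLE (m.degree + 1 + l - 3) :=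
      degLE_mono (by omega) (X_mul_mem_degLE i (ih hr' l c hc hcr))
    rw [varMode_top hi hcr, show (2 * (r : ℕ) - 1 - 1 - (2 * (r : ℕ) - 1) : ℤ) = -1 by ring] at h
    rw [Derivation.leibniz, pderiv_X]
    by_cases hir : i = r
    · subst hir
      have h3 : poleCoeff i • (mode (monomial m 1) (-1) (pderiv i c) - monomial m 1 * pderiv i c)
          ∈ degLE (m.degree + 1 + l - 3) := Submodule.smul_mem _ _ (degLE_mono (by omega)
            (mode_neg_one_sub_mul_mem_degLE m _ _ (pderiv_mem_degLE i hc)))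
      rw [if_pos rfl, map_smul] at h
      convert add_mem (add_mem h h2) h3 using 1
      simp only [Pi.single_eq_same, smul_eq_mul, smul_eq_C_mul]
      ring
    · rw [if_neg hir, map_zero, add_zero] at h
      convert add_mem h h2 using 1
      simp only [Pi.single_eq_of_ne hir, smul_eq_mul, smul_eq_C_mul]
      ring

theorem mode_top (r : ℕ+) {k l : ℤ} {a c : Fock} (ha : a ∈ degLE k) (hc : c ∈ degLE l)
    (har : ∀ i ∈ a.vars, i ≤ r) (hcr : ∀ i ∈ c.vars, i ≤ r) :
    mode a (2 * r - 1) c - poleCoeff r • (pderiv r a * pderiv r c) ∈ degLE (k + l - 3) := by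
  have hcr' : ∀ t, r < t → pderiv t c = 0 := fun t ht =>
    pderiv_eq_zero_of_notMem_vars fun h => absurd (hcr t h) (not_le.mpr ht)
  have key := map_mem_of_support (modeLeft (2 * r - 1) c - poleCoeff r •
    (LinearMap.mulRight ℂ (pderiv r c)).comp (pderiv r).toLinearMap) (degLE (k + l - 3)) a
    (fun m hm => degLE_mono (by linarith [mem_degLE.mp ha m hm])
      (mode_monomial_top r m (fun i hi =>
        har i (mem_vars_iff_mem_support i |>.mpr ⟨m, hm, hi⟩)) l c hc hcr'))
  exact key

/-! ### The leading term of a vector multiplied by itself -/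

theorem isHomogeneous_iff_degree {p : Fock} {k : ℕ} :
    p.IsHomogeneous k ↔ ∀ m, coeff m p ≠ 0 → m.degree = k := by
  simp only [Finsupp.degree_eq_weight_one]
  exact ⟨fun h m hm => h hm, fun h m hm => h m hm⟩

theorem isHomogeneous_pderiv {p : Fock} {k : ℕ} (hp : p.IsHomogeneous k) (i : ℕ+) :
    (pderiv i p).IsHomogeneous (k - 1) := by
  rw [isHomogeneous_iff_degree] at *
  intro m hm
  rw [coeff_pderiv] at hm
  have := hp _ (left_ne_zero_of_mul hm)
  rw [map_add, Finsupp.degree_single] at this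
  omega

theorem eq_zero_of_isHomogeneous_of_mem_degLE {p : Fock} {k : ℕ} (hp : p.IsHomogeneous k) {l : ℤ}
    (hl : l < k) (h : p ∈ degLE l) : p = 0 := by
  ext m
  rw [coeff_zero]
  by_contra hm
  have h1 := isHomogeneous_iff_degree.mp hp m hm
  have h2 := mem_degLE.mp h m (mem_support_iff.mpr hm)
  omega

theorem pderiv_ne_zero_of_mem_vars {p : Fock} {i : ℕ+} (h : i ∈ p.vars) : pderiv i p ≠ 0 := by
  obtain ⟨m, hm, hi⟩ := (mem_vars_iff_mem_support i).mp h
  have hle : Finsupp.single i 1 ≤ m := by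
    rw [Finsupp.single_le_iff, Nat.one_le_iff_ne_zero]
    exact Finsupp.mem_support_iff.mp hi
  intro h0
  have h1 := congrArg (coeff (m - Finsupp.single i 1)) h0
  rw [coeff_pderiv, tsub_add_cancel_of_le hle, coeff_zero, mul_eq_zero] at h1
  rcases h1 with h1 | h1
  · exact mem_support_iff.mp hm h1
  · exact Nat.cast_add_one_ne_zero _ h1

/-- The leading term of the product `v_{(2r-1)} v`, where `r` is the highest index of a variable
in the component of highest degree of `v`. -/
theorem exists_leading_term (v : Fock) (hv : v.totalDegree ≠ 0) :
    ∃ (k : ℕ) (u : Fock) (r : ℕ+), 1 ≤ k ∧ v ∈ degLE k ∧ u.IsHomogeneous k ∧ u ≠ 0 ∧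
      v - u ∈ degLE (k - 1) ∧ (∀ i ∈ u.vars, i ≤ r) ∧ pderiv r u ≠ 0 ∧
      mode v (2 * r - 1) v - poleCoeff r • (pderiv r u) ^ 2 ∈ degLE (2 * k - 3) := by
  obtain ⟨k, hk⟩ : ∃ k, k = v.totalDegree := ⟨_, rfl⟩
  have hu := homogeneousComponent_isHomogeneous k v
  set u := homogeneousComponent k v with hu_def
  have hvk : v ∈ degLE k := by
    rw [mem_degLE]
    intro m hm
    rw [hk, Nat.cast_le]
    exact le_totalDegree hm
  have hw : v - u ∈ degLE (k - 1) := by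
    rw [mem_degLE]
    intro m hm
    rw [mem_support_iff, coeff_sub, hu_def, coeff_homogeneousComponent] at hm
    split_ifs at hm with h
    · simp at hm
    · have := mem_degLE.mp hvk m (mem_support_iff.mpr (by simpa using hm))
      omega
  obtain ⟨m, hmv, hmk⟩ := v.support.exists_mem_eq_sup
    (support_nonempty.mpr fun h => hv (by rw [h, totalDegree_zero])) fun m => m.sum fun _ e => e
  have hmdeg : m.degree = k := (hk.trans hmk).symm
  have hmu : coeff m u ≠ 0 := by
    rw [hu_def, coeff_homogeneousComponent, if_pos hmdeg]
    exact mem_support_iff.mp hmv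
  have hu0 : u ≠ 0 := fun h => hmu (by rw [h, coeff_zero])
  have hvars : u.vars.Nonempty := by
    obtain ⟨i, hi⟩ : m.support.Nonempty := by
      rw [Finsupp.support_nonempty_iff]
      rintro rfl
      rw [map_zero] at hmdeg
      omega
    exact ⟨i, (mem_vars_iff_mem_support i).mpr ⟨m, mem_support_iff.mpr hmu, hi⟩⟩
  refine ⟨k, u, u.vars.max' hvars, by omega, hvk, hu, hu0, hw, fun i hi => u.vars.le_max' i hi,
    pderiv_ne_zero_of_mem_vars (u.vars.max'_mem hvars), ?_⟩
  set r := u.vars.max' hvars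
  have huk : u ∈ degLE k := by
    rw [mem_degLE]
    intro m hm
    rw [isHomogeneous_iff_degree.mp hu m (mem_support_iff.mp hm)]
  have hr : 0 ≤ (2 * r - 1 : ℤ) := by
    have := r.pos
    omega
  have h1 := mode_top r huk huk (fun i hi => u.vars.le_max' i hi) (fun i hi => u.vars.le_max' i hi)
  have h2 := mode_mem_degLE huk hw hr
  have h3 := mode_mem_degLE hw hvk hr
  -- Both products involving `v - u` have degree at most `k + (k - 1) - 2 = 2k - 3`, whatever
  -- variables occur in `v - u`.
  have e : mode v (2 * r - 1) v = mode u (2 * r - 1) u + mode u (2 * r - 1) (v - u) +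
      mode (v - u) (2 * r - 1) v := by
    rw [mode_sub, map_sub, LinearMap.sub_apply]
    abel
  have h4 := add_mem (add_mem (degLE_mono (l := 2 * k - 3) (by omega) h1)
    (degLE_mono (l := 2 * k - 3) (by omega) h2)) (degLE_mono (l := 2 * k - 3) (by omega) h3)
  convert h4 using 1
  rw [e, sq]
  abel

theorem sq_notMem_degLE {p : Fock} {k : ℕ} (hp : p.IsHomogeneous k) (h0 : p ≠ 0) {l : ℤ}
    (hl : l < 2 * k) : p ^ 2 ∉ degLE l := fun h =>
  pow_ne_zero 2 h0 (eq_zero_of_isHomogeneous_of_mem_degLE (hp.pow 2) (by push_cast; omega) h)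

/-! ### The quadratic part of a Virasoro vector -/

theorem eq_zero_or_single_of_degree_le_one {m : ℕ+ →₀ ℕ} (h : m.degree ≤ 1) :
    m = 0 ∨ ∃ i, m = Finsupp.single i 1 := by
  by_cases h0 : m = 0
  · exact .inl h0
  · obtain ⟨i, hi⟩ := Finsupp.support_nonempty_iff.mpr h0
    have hle : Finsupp.single i 1 ≤ m := by
      rw [Finsupp.single_le_iff, Nat.one_le_iff_ne_zero]
      exact Finsupp.mem_support_iff.mp hi
    have h1 := tsub_add_cancel_of_le hle
    have h2 := congrArg Finsupp.degree h1
    rw [map_add, Finsupp.degree_single] at h2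
    have h3 : (m - Finsupp.single i 1).degree = 0 := by omega
    rw [Finsupp.degree_eq_zero_iff] at h3
    rw [h3, zero_add] at h1
    exact .inr ⟨i, h1.symm⟩

theorem eq_C_of_totalDegree {v : Fock} (h : v.totalDegree = 0) : v = C (coeff 0 v) :=
  totalDegree_eq_zero_iff_eq_C.mp h

theorem mode_C_of_nonneg (t : ℂ) {n : ℤ} (hn : 0 ≤ n) (c : Fock) : mode (C t) n c = 0 := by
  have h : (C t : Fock) = t • 1 := by rw [smul_eq_C_mul, mul_one]
  rw [h, mode_smul, LinearMap.smul_apply, mode_one_of_ne (by omega), smul_zero]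

/-- The square `(∂_r u)²` has degree exactly `2k - 2`, so `v_{(2r-1)} v` cannot have degree at most
`2k - 3`. The Virasoro relations satisfy this only for `r = 1` and `k = 2`. -/
theorem sub_half_sq_mem_degLE {v : Fock} (hv : IsVirasoroVector v) :
    v - (1 / 2 : ℂ) • X 1 ^ 2 ∈ degLE 1 := by
  obtain ⟨hv0, h4, ⟨c, h3⟩, -, h1, -⟩ := hv
  have hnonconst : v.totalDegree ≠ 0 := by
    intro h
    rw [eq_C_of_totalDegree h, mode_C_of_nonneg _ (by norm_num)] at h1
    have := (smul_eq_zero.mp h1.symm).resolve_left two_ne_zero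
    rw [← eq_C_of_totalDegree h] at this
    exact hv0 this
  obtain ⟨k, u, r, hk, hvk, hu, hu0, hw, hr, hpd, hlead⟩ := exists_leading_term v hnonconst
  have hnot : v ∉ degLE (k - 1) := fun h => hu0 (eq_zero_of_isHomogeneous_of_mem_degLE hu
    (l := k - 1) (by omega) (by simpa using sub_mem h hw))
  have hsq : (pderiv r u) ^ 2 ∉ degLE (2 * k - 3) :=
    sq_notMem_degLE (isHomogeneous_pderiv hu r) hpd (by omega)
  have hnotlead : mode v (2 * r - 1) v ∉ degLE (2 * k - 3) := fun h => hsq (by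
    have := sub_mem h hlead
    rw [sub_sub_cancel] at this
    exact (Submodule.smul_mem_iff _ (poleCoeff_ne_zero r)).mp this)
  -- For `k = 1` the product `v_{(1)} v = 2v` would be constant.
  have hk1 : k ≠ 1 := by
    rintro rfl
    have := mode_mem_degLE hvk hvk (n := 1) (by norm_num)
    rw [h1, Submodule.smul_mem_iff _ two_ne_zero] at this
    exact hnot (degLE_mono (by norm_num) this)
  have hr1 : r = 1 := by
    by_contra hne
    have hr2 : 2 ≤ (r : ℕ) := by
      have := r.pos
      have : (r : ℕ) ≠ 1 := fun h => hne (PNat.coe_injective h)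
      omega
    -- For `r ≥ 2` the index `2r - 1` is at least `3`, where the product is a constant; and `2k - 3
    -- ≥ 1`.
    apply hnotlead
    by_cases h : (r : ℕ) = 2
    · rw [h, show (2 * (2 : ℕ) - 1 : ℤ) = 3 by norm_num, h3]
      exact degLE_mono (by omega) (C_mem_degLE _)
    · rw [h4 (2 * r - 1) (by omega)]
      exact zero_mem _
  subst hr1
  rw [show (2 * ((1 : ℕ+) : ℕ) - 1 : ℤ) = 1 by norm_num, h1, poleCoeff_one, one_smul] at hlead
  -- For `k ≥ 3` one has `k ≤ 2k - 3`, so `v_{(1)} v = 2v` is too small in degree.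
  have hk2 : k = 2 := by
    by_contra hne
    have := sub_mem ((degLE (2 * k - 3)).smul_mem (2 : ℂ) (degLE_mono (by omega) hvk)) hlead
    rw [sub_sub_cancel] at this
    exact hsq this
  subst hk2
  have hu2 : u = coeff (Finsupp.single 1 2) u • X 1 ^ 2 := by
    classical
    ext m
    rw [coeff_smul, coeff_X_pow, smul_eq_mul]
    split_ifs with h
    · rw [h, mul_one]
    · rw [mul_zero]
      by_contra hm
      have hdeg := isHomogeneous_iff_degree.mp hu m hm
      have hsupp : m.support ⊆ {1} := fun i hi => by
        have := hr i ((mem_vars_iff_mem_support i).mpr ⟨m, mem_support_iff.mpr hm, hi⟩)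
        simpa using this
      rw [Finsupp.support_subset_singleton] at hsupp
      rw [hsupp, Finsupp.degree_single] at hdeg
      rw [hdeg] at hsupp
      exact h hsupp.symm
  set γ := coeff (Finsupp.single 1 2) u
  have hpdu : pderiv 1 u = (2 * γ) • X 1 := by
    rw [hu2, Derivation.map_smul, pderiv_pow, pderiv_X_self]
    simp only [smul_eq_C_mul, map_mul, map_ofNat, Nat.cast_ofNat]
    ring
  -- Comparing quadratic parts in `v_{(1)} v = 2v` gives `(2γ)² = 2γ`.
  have hγ : γ = 1 / 2 := by
    have hmem : (2 * γ - 4 * γ ^ 2) • X 1 ^ 2 ∈ degLE 1 := by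
      have h5 := sub_mem hlead (Submodule.smul_mem _ (2 : ℂ) hw)
      rw [hpdu] at h5
      rw [show (2 * (2 : ℕ) - 3 : ℤ) = 1 by norm_num] at h5
      convert h5 using 1
      rw [smul_sub]
      nth_rw 1 [hu2]
      simp only [smul_eq_C_mul, map_mul, map_sub, map_pow, map_ofNat]
      ring
    have h0 : 2 * γ - 4 * γ ^ 2 = 0 := by
      by_contra hne
      rw [Submodule.smul_mem_iff _ hne] at hmem
      exact sq_notMem_degLE (isHomogeneous_X ℂ 1) (X_ne_zero 1) (by norm_num) hmem
    have hγ0 : γ ≠ 0 := fun h => hu0 (by rw [hu2, h, zero_smul])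
    have h1 : (2 * γ) * (1 - 2 * γ) = 0 := by linear_combination h0
    rcases mul_eq_zero.mp h1 with h | h
    · exact absurd (by simpa using h) hγ0
    · linear_combination -h / 2
  rw [hu2, hγ] at hw
  exact hw

/-! ### Constant terms and the classification of Virasoro vectors -/

theorem constantCoeff_smul_eq_mul (t : ℂ) (p : Fock) :
    constantCoeff (t • p) = t * constantCoeff p := by
  rw [smul_eq_C_mul, map_mul, constantCoeff_C]

theorem constantCoeff_varMode_of_neg (i : ℕ+) {j : ℤ} (hj : j < 0) (p : Fock) :
    constantCoeff (varMode i j p) = 0 := by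
  obtain ⟨γ, t, h⟩ := varMode_of_neg i hj
  rw [h, constantCoeff_smul_eq_mul, map_mul, constantCoeff_X, zero_mul, mul_zero]

theorem constantCoeff_pderiv (i : ℕ+) (p : Fock) :
    constantCoeff (pderiv i p) = coeff (Finsupp.single i 1) p := by
  rw [constantCoeff_eq, coeff_pderiv, zero_add]
  simp

/-- A constant term requires a double contraction. This only sees the quadratic part `½ x_1²`, hence
uses the mode of index `1` twice, which happens at `n = 3` alone. -/
theorem constantCoeff_mode_X_one_sq {v : Fock} (hv : v - (1 / 2 : ℂ) • X 1 ^ 2 ∈ degLE 1) {n : ℤ}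
    (h3 : n ≠ 3) : constantCoeff (mode (X 1 ^ 2) n v) = 0 := by
  have hX : (X 1 : Fock) = monomial (Finsupp.single 1 1) 1 := rfl
  have hfin := mode_X_mul_finite 1 (X 1) n v
  have h := mode_X_mul 1 (Finsupp.single 1 1) (fun _ _ => one_le) n v
  rw [← hX, ← sq] at h
  have hmem := finsum_sub_sum_mem (LinearMap.ker (lcoeff ℂ (0 : ℕ+ →₀ ℕ))) hfin ∅ (by
    intro j _
    rw [LinearMap.mem_ker, lcoeff_apply, ← constantCoeff_eq]
    unfold normalOrderVarTerm
    split_ifs with hj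
    · exact constantCoeff_varMode_of_neg 1 hj _
    · rw [mode_X]
      by_cases hj' : n - 1 - j < 0
      · exact constantCoeff_varMode_of_neg 1 hj' _
      · rcases varMode_of_nonneg 1 (not_lt.mp hj) with hz | ⟨t, ht, γ, hγ⟩
        · rw [hz, LinearMap.zero_apply, map_zero, map_zero]
        · rcases varMode_of_nonneg 1 (not_lt.mp hj') with hz | ⟨s, hs, δ, hδ⟩
          · rw [hz, LinearMap.zero_apply, map_zero]
          · rw [hγ, map_smul, hδ, constantCoeff_smul_eq_mul, constantCoeff_smul_eq_mul]
            have hl : pderiv s (pderiv t (v - (1 / 2 : ℂ) • X 1 ^ 2)) = 0 := by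
              have := mem_degLE.mp (pderiv_mem_degLE s (pderiv_mem_degLE t hv))
              rw [← support_eq_empty, Finset.eq_empty_iff_forall_notMem]
              intro m hm
              have := this m hm
              omega
            rw [map_sub, map_sub, sub_eq_zero] at hl
            rw [hl, Derivation.map_smul, Derivation.map_smul, constantCoeff_smul_eq_mul, pderiv_pow]
            by_cases ht1 : t = 1
            · have hs1 : s ≠ 1 := by
                rintro rfl
                subst ht1
                simp at ht hs
                omega
              subst ht1
              simp [pderiv_X_of_ne hs1.symm]
            · simp [pderiv_X_of_ne (Ne.symm ht1)])
  rw [← h, Finset.sum_empty, sub_zero, LinearMap.mem_ker, lcoeff_apply, ← constantCoeff_eq] at hmem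
  exact hmem

theorem constantCoeff_varMode_top (s : ℕ+) (v : Fock) :
    constantCoeff (varMode s (2 * s - 1) v) = poleCoeff s * coeff (Finsupp.single s 1) v := by
  rw [show (2 * (s : ℕ) - 1 : ℤ) = (s : ℕ) + (s : ℕ) - 1 by ring, varMode_add, constantCoeff_smul_eq_mul,
    constantCoeff_pderiv]
  rfl

/-- Constants arise from pairs `x_i`, `x_t` with `i + t = 2s`; the hypothesis `hs` discards the
pairs off the diagonal. -/
theorem constantCoeff_mode_of_mem_degLE_one {l v : Fock} (hl : l ∈ degLE 1) (s : ℕ+)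
    (hs : ∀ i t : ℕ+, i ≠ s → (i : ℕ) + t = 2 * s → coeff (Finsupp.single i 1) l ≠ 0 →
      coeff (Finsupp.single t 1) v = 0) :
    constantCoeff (mode l (2 * s - 1) v) =
      poleCoeff s * coeff (Finsupp.single s 1) l * coeff (Finsupp.single s 1) v := by
  classical
  have hs0 := s.pos
  set c := coeff (Finsupp.single s 1) l with hc
  have key := map_mem_of_support ((lcoeff ℂ (0 : ℕ+ →₀ ℕ)).comp (modeLeft (2 * s - 1) v)) ⊥
    (l - c • X s) (by
      intro m hm
      rw [Submodule.mem_bot, LinearMap.comp_apply, lcoeff_apply, modeLeft_apply,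
        ← constantCoeff_eq]
      rw [mem_support_iff, coeff_sub, coeff_smul, coeff_X, smul_eq_mul] at hm
      have hms : m ≠ Finsupp.single s 1 := by
        rintro rfl
        simp [hc] at hm
      rw [if_neg hms.symm, mul_zero, sub_zero] at hm
      have hdeg : m.degree ≤ 1 := by
        exact_mod_cast mem_degLE.mp hl m (mem_support_iff.mpr hm)
      rcases eq_zero_or_single_of_degree_le_one hdeg with rfl | ⟨i, rfl⟩
      · change constantCoeff (mode 1 _ v) = 0
        rw [mode_one_of_ne (by omega), map_zero]
      · change constantCoeff (mode (X i) _ v) = 0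
        rw [mode_X]
        rcases varMode_of_nonneg i (j := 2 * s - 1) (by omega) with hz | ⟨t, ht, γ, hγ⟩
        · rw [hz, LinearMap.zero_apply, map_zero]
        · have his : i ≠ s := fun h => hms (by rw [h])
          rw [hγ, constantCoeff_smul_eq_mul, constantCoeff_pderiv, hs i t his (by omega) hm, mul_zero])
  rw [Submodule.mem_bot, map_sub, sub_eq_zero, map_smul, LinearMap.comp_apply,
    LinearMap.comp_apply, lcoeff_apply, lcoeff_apply, modeLeft_apply, modeLeft_apply,
    ← constantCoeff_eq, mode_X, constantCoeff_varMode_top, smul_eq_mul] at key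
  rw [key]
  ring

/-- Virasoro vectors of the Fock space are the vectors `½(x₁ + μ)² + l x₂`. -/
theorem IsVirasoroVector.eq_standardVector {v : Fock} (hv : IsVirasoroVector v) :
    ∃ μ l : ℂ, v = C (μ ^ 2 / 2) + μ • X 1 + standardVector l := by
  classical
  have hl := sub_half_sq_mem_degLE hv
  obtain ⟨-, h4, -, -, h1, -⟩ := hv
  set l := v - (1 / 2 : ℂ) • X 1 ^ 2 with hl_def
  have hvl : v = (1 / 2 : ℂ) • X 1 ^ 2 + l := by rw [hl_def]; abel
  have hcoeff : ∀ i, coeff (Finsupp.single i 1) v = coeff (Finsupp.single i 1) l := by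
    intro i
    rw [hvl, coeff_add, coeff_smul, coeff_X_pow, if_neg, smul_zero, zero_add]
    intro h
    have := congrArg Finsupp.degree h
    rw [Finsupp.degree_single, Finsupp.degree_single] at this
    omega
  -- The case `s = 2` is the index `3` of the central charge, where `½ x_1²` also contributes a
  -- constant.
  have key : ∀ s : ℕ+, (s : ℕ) ≠ 2 → (∀ i t : ℕ+, i ≠ s → (i : ℕ) + t = 2 * s →
      coeff (Finsupp.single i 1) l ≠ 0 → coeff (Finsupp.single t 1) l = 0) →
      constantCoeff (mode v (2 * s - 1) v) = poleCoeff s * coeff (Finsupp.single s 1) l ^ 2 := by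
    intro s hs h
    have hs0 := s.pos
    have e := constantCoeff_mode_of_mem_degLE_one (v := v) hl s
      (fun i t hi hit hne => (hcoeff t).trans (h i t hi hit hne))
    have e2 := constantCoeff_mode_X_one_sq hl (n := 2 * s - 1) (by omega)
    have e3 : mode v (2 * s - 1) = (1 / 2 : ℂ) • mode (X 1 ^ 2) (2 * s - 1) +
        mode l (2 * s - 1) := by
      rw [← mode_smul, ← mode_add, ← hvl]
    rw [e3, LinearMap.add_apply, LinearMap.smul_apply, map_add, constantCoeff_smul_eq_mul, e2, e, hcoeff]
    ring
  have hvars : ∀ i : ℕ+, 2 < i → coeff (Finsupp.single i 1) l = 0 := by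
    by_contra! hex
    obtain ⟨i, hi2, hi⟩ := hex
    have hmem : ∀ i, coeff (Finsupp.single i 1) l ≠ 0 → i ∈ l.vars := fun i hi =>
      (mem_vars_iff_mem_support i).mpr ⟨_, mem_support_iff.mpr hi, by simp⟩
    have hne : l.vars.Nonempty := ⟨i, hmem i hi⟩
    set s := l.vars.max' hne with hs
    have hsm : s ∈ l.vars := l.vars.max'_mem hne
    have hs2 : (2 : ℕ) < s := lt_of_lt_of_le hi2 (l.vars.le_max' i (hmem i hi))
    have hmax : ∀ i, coeff (Finsupp.single i 1) l ≠ 0 → (i : ℕ) ≤ s := fun i hi =>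
      l.vars.le_max' i (hmem i hi)
    have hsc : coeff (Finsupp.single s 1) l ≠ 0 := by
      obtain ⟨m, hm, hms⟩ := (mem_vars_iff_mem_support s).mp hsm
      have hdeg : m.degree ≤ 1 := by exact_mod_cast mem_degLE.mp hl m hm
      rcases eq_zero_or_single_of_degree_le_one hdeg with rfl | ⟨i, rfl⟩
      · simp at hms
      · have : s = i := by simpa using hms
        rw [this]
        exact mem_support_iff.mp hm
    -- For the highest index `s`, the relation `i + t = 2s` with `i, t ≤ s` forces `i = t = s`.
    have e := key s (by omega) (fun i t hi hit hne => by
      by_contra ht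
      have h1 := hmax i hne
      have h2 := hmax t ht
      exact hi (PNat.coe_injective (by omega)))
    rw [h4 (2 * s - 1) (by omega), map_zero] at e
    exact mul_ne_zero (poleCoeff_ne_zero s) (pow_ne_zero 2 hsc) e.symm
  -- This is the constant term of `v_{(1)} v = 2v`.
  have hconst : coeff 0 l = coeff (Finsupp.single 1 1) l ^ 2 / 2 := by
    have e := key 1 (by norm_num) (fun i t hi hit _ => by
      have h1 := i.pos
      have h2 := t.pos
      rw [PNat.one_coe] at hit
      exact absurd (PNat.coe_injective (by rw [PNat.one_coe]; omega)) hi)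
    rw [show (2 * ((1 : ℕ+) : ℕ) - 1 : ℤ) = 1 by norm_num, h1, constantCoeff_smul_eq_mul, hvl, map_add,
      constantCoeff_smul_eq_mul, map_pow, constantCoeff_X, poleCoeff_one, one_mul,
      constantCoeff_eq] at e
    linear_combination e / 2
  refine ⟨coeff (Finsupp.single 1 1) l, coeff (Finsupp.single 2 1) l, ?_⟩
  rw [standardVector, ← hconst]
  have hlin : l = C (coeff 0 l) + coeff (Finsupp.single 1 1) l • X 1 +
      coeff (Finsupp.single 2 1) l • X 2 := by
    ext m
    rw [coeff_add, coeff_add, coeff_C, coeff_smul, coeff_smul, coeff_X, coeff_X, smul_eq_mul,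
      smul_eq_mul]
    by_cases hm : coeff m l = 0
    · have h0 : (if 0 = m then coeff 0 l else 0) = 0 := by
        split_ifs with h
        · subst h
          exact hm
        · rfl
      have h1 : ∀ i, coeff (Finsupp.single i 1) l * (if Finsupp.single i 1 = m then 1 else 0) = 0 := by
        intro i
        split_ifs with h
        · subst h
          rw [hm, zero_mul]
        · rw [mul_zero]
      rw [h0, h1, h1, hm, add_zero, add_zero]
    have hdeg : m.degree ≤ 1 := by
      exact_mod_cast mem_degLE.mp hl m (mem_support_iff.mpr hm)
    rcases eq_zero_or_single_of_degree_le_one hdeg with rfl | ⟨i, rfl⟩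
    · simp
    · have hi : ¬ 2 < i := fun h => hm (hvars i h)
      have hi' : i = 1 ∨ i = 2 := by
        have h0 := i.pos
        have h1 : (i : ℕ) ≤ 2 := not_lt.mp hi
        by_cases h : (i : ℕ) = 1
        · exact .inl (PNat.coe_injective h)
        · exact .inr (PNat.coe_injective (show (i : ℕ) = 2 by omega))
      have h12 : Finsupp.single (1 : ℕ+) 1 ≠ Finsupp.single (2 : ℕ+) 1 := fun h => by
        have := (Finsupp.single_left_inj one_ne_zero).mp h
        exact absurd this (by decide)
      rw [if_neg (Finsupp.single_ne_zero.mpr one_ne_zero).symm]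
      rcases hi' with rfl | rfl
      · rw [if_pos rfl, if_neg h12.symm]
        ring
      · rw [if_pos rfl, if_neg h12]
        ring
  nth_rw 1 [hvl, hlin]
  abel

/-! ### Automorphisms on the generator -/

theorem C_eq_smul_one (t : ℂ) : (C t : Fock) = t • 1 := by rw [smul_eq_C_mul, mul_one]

theorem vertexAut_map_one {σ : Fock ≃ₗ[ℂ] Fock} (hσ : σ ∈ vertexAut) : σ 1 = 1 := by
  have h := hσ (-1) 1 (σ.symm 1)
  rwa [mode_one_neg_one, σ.apply_symm_apply, mode_neg_one_apply_one, eq_comm] at h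

theorem vertexAut_map_C {σ : Fock ≃ₗ[ℂ] Fock} (hσ : σ ∈ vertexAut) (t : ℂ) :
    σ (C t) = C t := by
  rw [C_eq_smul_one, map_smul, vertexAut_map_one hσ]

theorem varMode_one_one (p : Fock) : varMode 1 1 p = pderiv 1 p := by
  have h := varMode_add 1 1 p
  rw [show ((1 : ℕ+) : ℕ) + ((1 : ℕ+) : ℕ) - 1 = (1 : ℤ) by norm_num] at h
  rw [h]
  simp

theorem mode_X_one_X_one {n : ℤ} (hn : 2 ≤ n) : mode (X 1) n (X 1) = 0 := by
  rw [mode_X]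
  rcases varMode_of_nonneg 1 (j := n) (by omega) with h | ⟨t, ht, γ, h⟩
  · rw [h, LinearMap.zero_apply]
  · have h1 : (1 : ℕ+) ≠ t := by
      rintro rfl
      rw [PNat.one_coe] at ht
      omega
    rw [h, pderiv_X_of_ne h1, smul_zero]

/-- In particular `x_i = x_1_{(-i)} 1`, so `x_1` determines derivations and automorphisms. -/
theorem mode_X_neg (i : ℕ+) (c : Fock) : mode (X 1) (-(i : ℕ)) c = X i * c := by
  rw [mode_X, varMode_eq, show (-((i : ℕ) : ℤ) + 1 - ((1 : ℕ+) : ℕ)) = -(i : ℕ) by simp,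
    LinearMap.smul_apply, heis_neg_coe_apply]
  simp

theorem mode_X_neg_one (i : ℕ+) (c : Fock) : mode (X i) (-1) c = X i * c := by
  rw [mode_X, varMode_neg_one]

/-- Automorphisms are affine on the generator `x₁`. -/
theorem vertexAut_map_X_one {σ : Fock ≃ₗ[ℂ] Fock} (hσ : σ ∈ vertexAut) :
    ∃ ε c : ℂ, σ (X 1) = ε • X 1 + C c := by
  classical
  set y := σ (X 1) with hy
  have hy1 : mode y 1 y = 1 := by
    rw [hy, ← hσ, mode_X, varMode_one_one, pderiv_X_self, vertexAut_map_one hσ]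
  have hy2 : ∀ n : ℤ, 2 ≤ n → mode y n y = 0 := fun n hn => by
    rw [hy, ← hσ, mode_X_one_X_one hn, map_zero]
  have hdeg : y.totalDegree ≠ 0 := by
    intro h
    rw [eq_C_of_totalDegree h, mode_C_of_nonneg _ (by norm_num)] at hy1
    exact zero_ne_one hy1
  obtain ⟨k, u, r, hk, hyk, hu, hu0, hw, hr, hpd, hlead⟩ := exists_leading_term y hdeg
  have hnot : mode y (2 * r - 1) y ∉ degLE (2 * k - 3) := fun h =>
    sq_notMem_degLE (isHomogeneous_pderiv hu r) hpd (l := 2 * k - 3) (by omega) (by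
      have := sub_mem h hlead
      rw [sub_sub_cancel] at this
      exact (Submodule.smul_mem_iff _ (poleCoeff_ne_zero r)).mp this)
  -- A leading pole of index above `1` contradicts `y_{(n)} y = 0` for `n ≥ 2`; then `y_{(1)} y = 1`
  -- leaves only degree one.
  have hr1 : r = 1 := by
    by_contra hne
    have := r.pos
    have : (r : ℕ) ≠ 1 := fun h => hne (PNat.coe_injective h)
    rw [hy2 (2 * r - 1) (by omega)] at hnot
    exact hnot (zero_mem _)
  subst hr1
  rw [show (2 * ((1 : ℕ+) : ℕ) - 1 : ℤ) = 1 by norm_num, hy1] at hnot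
  have hk1 : k = 1 := by
    by_contra hne
    exact hnot (degLE_mono (by omega) one_mem_degLE)
  subst hk1
  refine ⟨coeff (Finsupp.single 1 1) u, coeff 0 (y - u), ?_⟩
  have h1 : u = coeff (Finsupp.single 1 1) u • X 1 := by
    ext m
    rw [coeff_smul, coeff_X, smul_eq_mul]
    split_ifs with h
    · rw [h, mul_one]
    · rw [mul_zero]
      by_contra hm
      have hdeg := isHomogeneous_iff_degree.mp hu m hm
      rcases eq_zero_or_single_of_degree_le_one hdeg.le with rfl | ⟨i, rfl⟩
      · simp at hdeg
      · have := hr i ((mem_vars_iff_mem_support i).mpr ⟨_, mem_support_iff.mpr hm, by simp⟩)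
        exact h (by rw [le_antisymm this one_le])
  have h2 : y - u = C (coeff 0 (y - u)) := by
    ext m
    rw [coeff_C]
    split_ifs with h
    · rw [h]
    · by_contra hm
      have h3 := mem_degLE.mp hw m (mem_support_iff.mpr hm)
      exact h ((Finsupp.degree_eq_zero_iff m).mp (by omega)).symm
  rw [← h1, ← h2]
  abel

/-! ### Reduction to polynomials in one variable -/

/-- The reduction `x₁ ↦ X`, `x_i ↦ 0` for `i ≥ 2` of the Fock space. -/
noncomputable def reduction : Fock →ₐ[ℂ] Polynomial ℂ :=
  aeval fun i => if i = 1 then Polynomial.X else 0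

theorem reduction_X_one : reduction (X 1) = Polynomial.X := by simp [reduction]

theorem reduction_X_of_ne {i : ℕ+} (hi : i ≠ 1) : reduction (X i) = 0 := by simp [reduction, hi]

theorem reduction_varMode_of_lt (i : ℕ+) {j : ℤ} (hj : j < -1) (c : Fock) :
    reduction (varMode i j c) = 0 := by
  obtain ⟨γ, t, ht, h⟩ := varMode_of_lt i hj
  have h1 : t ≠ 1 := by
    rintro rfl
    exact absurd ht (by decide)
  rw [h, map_smul, map_mul, reduction_X_of_ne h1, zero_mul, smul_zero]

/-- Either a variable other than `x_1` is created, or a non-negative `j` leaves an index `n - 1 - j`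
still below `-1`. -/
theorem reduction_mode_monomial_of_lt (m : ℕ+ →₀ ℕ) : ∀ n : ℤ, n < -1 → ∀ c,
    reduction (mode (monomial m 1) n c) = 0 := by
  induction m using monomial_sorted_induction with
  | h0 =>
    intro n hn c
    have h1 : (monomial (0 : ℕ+ →₀ ℕ) (1 : ℂ)) = 1 := rfl
    rw [h1, mode_one_of_ne (by omega), map_zero]
  | hX i m hm ih =>
    intro n hn c
    have h := mode_X_mul_mem (LinearMap.ker reduction.toLinearMap) i m hm n c
      (fun j hj => reduction_varMode_of_lt i hj _) (fun j hj => ih _ (by omega) _)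
    rw [LinearMap.mem_ker, AlgHom.toLinearMap_apply, map_sub, map_mul, ih n hn, mul_zero,
      sub_zero] at h
    rwa [← X_mul_monomial]

theorem reduction_mode_of_lt (a : Fock) {n : ℤ} (hn : n < -1) (c : Fock) :
    reduction (mode a n c) = 0 :=
  (Submodule.mem_bot ℂ).mp (map_mem_of_support (reduction.toLinearMap.comp (modeLeft n c)) ⊥ a
    fun m _ => (Submodule.mem_bot ℂ).mpr (reduction_mode_monomial_of_lt m n hn c))

theorem reduction_mode_neg_one (a c : Fock) :
    reduction (mode a (-1) c) = reduction a * reduction c := by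
  have key : reduction.toLinearMap.comp (modeLeft (-1) c) =
      (LinearMap.mulRight ℂ (reduction c)).comp reduction.toLinearMap := by
    refine linearMap_ext_sorted ?_ fun i m hm ih => ?_
    · simp [modeLeft_apply, mode_one_neg_one]
    · have h := mode_X_mul_mem (LinearMap.ker reduction.toLinearMap) i m hm (-1) c
        (fun j hj => reduction_varMode_of_lt i hj _)
        (fun j hj => reduction_mode_of_lt _ (by omega) _)
      rw [LinearMap.mem_ker, AlgHom.toLinearMap_apply, map_sub, map_mul, sub_eq_zero] at h
      simp only [LinearMap.comp_apply, AlgHom.toLinearMap_apply, modeLeft_apply,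
        LinearMap.mulRight_apply] at ih ⊢
      rw [h, ih, map_mul, mul_assoc]
  exact LinearMap.congr_fun key a

theorem varMode_X_one_of_ne (i : ℕ+) {j : ℤ} (h0 : 0 ≤ j) (hj : j ≠ i) :
    varMode i j (X 1) = 0 := by
  rcases varMode_of_nonneg i h0 with h | ⟨t, ht, γ, h⟩
  · rw [h, LinearMap.zero_apply]
  · have h1 : (1 : ℕ+) ≠ t := by
      rintro rfl
      rw [PNat.one_coe] at ht
      omega
    rw [h, pderiv_X_of_ne h1, smul_zero]

/-- Contracting `x_i` with `x_1` leaves the index `-i`. For `i = 1` this creates the remaining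
monomial, for `i ≥ 2` it is killed by the reduction, and the Leibniz rule results. -/
theorem reduction_mode_one_X_one (a : Fock) :
    reduction (mode a 1 (X 1)) = Polynomial.derivative (reduction a) := by
  have key : reduction.toLinearMap.comp (modeLeft 1 (X 1)) =
      Polynomial.derivative.comp reduction.toLinearMap := by
    refine linearMap_ext_sorted ?_ fun i m hm ih => ?_
    · simp [modeLeft_apply, mode_one_of_ne]
    · have h := mode_X_mul_mem_of_two (LinearMap.ker reduction.toLinearMap) i m hm 1 (X 1) i (by omega)
        (fun j hj => reduction_varMode_of_lt i hj _)
        (fun j hj hne => by rw [varMode_X_one_of_ne i hj hne, map_zero]; exact zero_mem _)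
      rw [LinearMap.mem_ker, AlgHom.toLinearMap_apply, map_sub, map_add, map_mul,
        sub_eq_zero] at h
      simp only [LinearMap.comp_apply, AlgHom.toLinearMap_apply, modeLeft_apply] at ih ⊢
      rw [h, ih, map_mul, Polynomial.derivative_mul]
      by_cases hi : i = 1
      · subst hi
        rw [reduction_X_one, PNat.one_coe, Nat.cast_one, varMode_one_one, pderiv_X_self,
          show (1 : ℤ) - 1 - 1 = -1 by norm_num, mode_neg_one_apply_one, Polynomial.derivative_X,
          one_mul, add_comm]
      · have hi2 : (i : ℕ) ≠ 1 := fun h => hi (PNat.coe_injective h)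
        have := i.pos
        rw [reduction_X_of_ne hi, reduction_mode_of_lt _ (by omega)]
        simp
  exact LinearMap.congr_fun key a

theorem reduction_pderiv_one (a : Fock) :
    reduction (pderiv 1 a) = Polynomial.derivative (reduction a) := by
  induction a using MvPolynomial.induction_on with
  | C t => simp [reduction]
  | add p q hp hq => rw [map_add, map_add, map_add, map_add, hp, hq]
  | mul_X p i hp =>
    rw [pderiv_mul, map_add, map_mul, map_mul, map_mul, hp, Polynomial.derivative_mul]
    by_cases hi : i = 1
    · subst hi
      rw [pderiv_X_self, reduction_X_one, Polynomial.derivative_X, map_one]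
    · rw [pderiv_X_of_ne hi, reduction_X_of_ne hi, map_zero, map_zero]

/-! ### Derivations modulo the reduction -/

/-- Derivations for all the products of the vertex algebra. -/
def IsVertexDerivation (D : Module.End ℂ Fock) : Prop :=
  ∀ (n : ℤ) (b c : Fock), D (mode b n c) = mode (D b) n c + mode b n (D c)

namespace IsVertexDerivation

variable {D : Module.End ℂ Fock}

theorem map_one (hD : IsVertexDerivation D) : D 1 = 0 := by
  have h := hD (-1) 1 1
  rw [mode_one_neg_one, mode_one_neg_one, mode_neg_one_apply_one] at h
  exact left_eq_add.mp h

theorem map_X (hD : IsVertexDerivation D) (i : ℕ+) : D (X i) = mode (D (X 1)) (-(i : ℕ)) 1 := by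
  have h := hD (-(i : ℕ)) (X 1) 1
  rwa [hD.map_one, map_zero, add_zero, mode_X_neg, mul_one] at h

/-- Apply `D` to `x_1_{(1)} x_1 = 1`: both terms reduce to the derivative of the reduction of `D
x_1`, so twice this derivative is zero. -/
theorem exists_reduction_map_X_one (hD : IsVertexDerivation D) :
    ∃ t : ℂ, reduction (D (X 1)) = Polynomial.C t := by
  have h := hD 1 (X 1) (X 1)
  rw [mode_X, varMode_one_one, varMode_one_one, pderiv_X_self, hD.map_one] at h
  have h2 := congrArg reduction h
  rw [_root_.map_zero, map_add, reduction_mode_one_X_one, reduction_pderiv_one, ← two_mul,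
    zero_eq_mul] at h2
  have h3 := h2.resolve_left two_ne_zero
  exact ⟨_, Polynomial.eq_C_of_natDegree_eq_zero
    (Polynomial.derivative_eq_zero.mp h3)⟩

theorem exists_reduction_map (hD : IsVertexDerivation D) :
    ∃ t : ℂ, ∀ q, reduction (D q) = Polynomial.C t * Polynomial.derivative (reduction q) := by
  obtain ⟨t, ht⟩ := hD.exists_reduction_map_X_one
  refine ⟨t, fun q => ?_⟩
  induction q using MvPolynomial.induction_on with
  | C s =>
    rw [C_eq_smul_one, map_smul, hD.map_one]
    simp
  | add p q hp hq => rw [map_add, map_add, map_add, map_add, hp, hq, mul_add]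
  | mul_X p i hp =>
    rw [mul_comm p, ← mode_X_neg_one, hD, map_add, reduction_mode_neg_one, reduction_mode_neg_one,
      reduction_mode_neg_one, hp, Polynomial.derivative_mul]
    by_cases hi : i = 1
    · subst hi
      rw [ht, reduction_X_one, Polynomial.derivative_X]
      ring
    · have hi2 : (i : ℕ) ≠ 1 := fun h => hi (PNat.coe_injective h)
      have := i.pos
      rw [hD.map_X, reduction_mode_of_lt _ (by omega), reduction_X_of_ne hi]
      simp

theorem exists_reduction_pow (hD : IsVertexDerivation D) (k : ℕ) :
    ∃ s : ℂ, reduction ((D ^ (k + 1)) (X 1)) = Polynomial.C s := by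
  obtain ⟨t, ht⟩ := hD.exists_reduction_map
  induction k with
  | zero => exact ⟨t, by rw [zero_add, pow_one, ht, reduction_X_one]; simp⟩
  | succ k ih =>
    obtain ⟨s, hs⟩ := ih
    exact ⟨0, by rw [pow_succ', Module.End.mul_apply, ht, hs]; simp⟩

end IsVertexDerivation

/-- The exponential of a derivation that is an automorphism translates `x₁`. -/
theorem exp_map_X_one {D : Module.End ℂ Fock} (hD : IsVertexDerivation D) {σ : Fock ≃ₗ[ℂ] Fock}
    (hσ : σ ∈ vertexAut) (h : IsExp D σ) : ∃ c : ℂ, σ (X 1) = X 1 + C c := by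
  obtain ⟨ε, c, hε⟩ := vertexAut_map_X_one hσ
  refine ⟨c, ?_⟩
  -- The functional reads the coefficient of `X` after reduction. All `D^k x_1` with `k ≥ 1` reduce
  -- to constants, so only the term `k = 0` contributes.
  have h1 := h (X 1) ((Polynomial.lcoeff ℂ 1).comp reduction.toLinearMap)
  have h2 : HasSum (fun k : ℕ => (k.factorial : ℂ)⁻¹ *
      ((Polynomial.lcoeff ℂ 1).comp reduction.toLinearMap) ((D ^ k) (X 1))) 1 := by
    convert hasSum_single 0 ?_ using 1
    · simp [reduction_X_one]
    · intro k hk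
      obtain ⟨k, rfl⟩ := Nat.exists_eq_succ_of_ne_zero hk
      obtain ⟨s, hs⟩ := hD.exists_reduction_pow k
      rw [LinearMap.comp_apply, AlgHom.toLinearMap_apply, hs, Polynomial.lcoeff_apply,
        Polynomial.coeff_C_of_ne_zero one_ne_zero, mul_zero]
  have h3 := h1.unique h2
  rw [hε] at h3
  have h4 : ε = 1 := by
    simpa [reduction_X_one, reduction] using h3
  rw [hε, h4, one_smul]

/-! ### Inner automorphisms preserve the coefficient of `x_2` -/

/-- The automorphisms that translate `x₁`. -/
noncomputable def translationAut : Subgroup (Fock ≃ₗ[ℂ] Fock) where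
  carrier := {σ | σ ∈ vertexAut ∧ ∃ c : ℂ, σ (X 1) = X 1 + C c}
  mul_mem' := by
    rintro σ τ ⟨hσ, c, hc⟩ ⟨hτ, d, hd⟩
    refine ⟨mul_mem hσ hτ, c + d, ?_⟩
    rw [LinearEquiv.mul_apply, hd, map_add, hc, vertexAut_map_C hσ, C_add, add_assoc]
  one_mem' := ⟨one_mem _, 0, by simp⟩
  inv_mem' := by
    rintro σ ⟨hσ, c, hc⟩
    refine ⟨inv_mem hσ, -c, σ.injective ?_⟩
    have h : ∀ x, σ (σ⁻¹ x) = x := fun x => σ.apply_symm_apply x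
    rw [h, map_add, hc, vertexAut_map_C hσ, C_neg]
    ring

theorem innerAut_le_translationAut : innerAut ≤ translationAut := by
  refine iSup_le fun m => (Subgroup.closure_le _).mpr ?_
  rintro σ ⟨hσ, D, ⟨-, hD⟩, hexp⟩
  exact ⟨hσ, exp_map_X_one hD hσ hexp⟩

theorem coeff_standardVector (l : ℂ) : coeff (Finsupp.single 2 1) (standardVector l) = l := by
  classical
  have h : Finsupp.single (1 : ℕ+) 2 ≠ Finsupp.single 2 1 := fun h => by
    have := congrArg Finsupp.degree h
    simp at this
  rw [standardVector, coeff_add, coeff_smul, coeff_smul, coeff_X_pow, coeff_X, if_neg h, if_pos rfl]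
  simp

theorem translationAut_standardVector {σ : Fock ≃ₗ[ℂ] Fock} (hσ : σ ∈ translationAut) {l l' : ℂ}
    (h : σ (standardVector l) = standardVector l') : l = l' := by
  classical
  obtain ⟨hσ, c, hc⟩ := hσ
  have h2 : σ (X 2) = X 2 := by
    have e : ∀ p : Fock, mode p (-2) 1 = mode p (-((2 : ℕ+) : ℕ)) 1 := fun p => rfl
    have h1 := hσ (-2) (X 1) 1
    rwa [hc, mode_add, LinearMap.add_apply, e, mode_X_neg, mul_one, vertexAut_map_one hσ, e,
      mode_X_neg, mul_one, C_eq_smul_one, mode_smul, LinearMap.smul_apply,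
      mode_one_of_ne (by norm_num), smul_zero, add_zero] at h1
  have h11 : σ (X 1 ^ 2) = X 1 ^ 2 + (2 * c) • X 1 + C (c ^ 2) := by
    have h1 := hσ (-1) (X 1) (X 1)
    rw [hc, mode_add, LinearMap.add_apply, mode_X_neg_one, mode_X_neg_one, C_eq_smul_one, mode_smul,
      LinearMap.smul_apply, mode_one_neg_one] at h1
    rw [sq, h1]
    simp only [smul_eq_C_mul, map_mul, map_pow, map_ofNat]
    ring
  have h3 : σ (standardVector l) = standardVector l + c • X 1 + C (c ^ 2 / 2) := by
    rw [standardVector, map_add, map_smul, map_smul, h2, h11, smul_add, smul_add, smul_smul]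
    have e : (1 / 2 : ℂ) * (2 * c) = c := by ring
    have e2 : (1 / 2 : ℂ) • (C (c ^ 2) : Fock) = C (c ^ 2 / 2) := by
      rw [smul_eq_C_mul, ← C_mul]
      congr 1
      ring
    rw [e, e2]
    abel
  have h12 : Finsupp.single (1 : ℕ+) 1 ≠ Finsupp.single (2 : ℕ+) 1 := fun h => by
    have := (Finsupp.single_left_inj one_ne_zero).mp h
    exact absurd this (by decide)
  have h4 := congrArg (coeff (Finsupp.single 2 1)) (h3.symm.trans h)
  rw [coeff_add, coeff_add, coeff_standardVector, coeff_standardVector, coeff_smul, coeff_X,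
    if_neg h12, coeff_C, if_neg (Finsupp.single_ne_zero.mpr one_ne_zero).symm] at h4
  simpa using h4

/-! ### The translations of `x_1` as automorphisms -/

/-- Needed because translating or differentiating the rest of a monomial need not give a monomial.
-/
theorem mode_X_mul_of_vars (i : ℕ+) (p : Fock) (h : ∀ j ∈ p.vars, i ≤ j) (n : ℤ) (c : Fock) :
    mode (X i * p) n c = ∑ᶠ j, normalOrderVarTerm i p n c j := by
  let S : Submodule ℂ Fock :=
    { carrier := {p | mode (X i * p) n c = ∑ᶠ j, normalOrderVarTerm i p n c j}
      zero_mem' := by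
        simp [mode, normalOrderVarTerm]
      add_mem' := by
        intro p q hp hq
        rw [Set.mem_ofPred_eq] at hp hq ⊢
        rw [mul_add, mode_add, LinearMap.add_apply, hp, hq,
          ← finsum_add_distrib (mode_X_mul_finite i p n c) (mode_X_mul_finite i q n c)]
        refine finsum_congr fun j => ?_
        unfold normalOrderVarTerm
        split_ifs <;> simp [mode_add]
      smul_mem' := by
        intro t p hp
        rw [Set.mem_ofPred_eq] at hp ⊢
        rw [mul_smul_comm, mode_smul, LinearMap.smul_apply, hp, smul_finsum]
        refine finsum_congr fun j => ?_
        unfold normalOrderVarTerm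
        split_ifs <;> simp [mode_smul] }
  exact map_mem_of_support LinearMap.id S p fun m hm => mode_X_mul i m (fun j hj =>
    h j ((mem_vars_iff_mem_support j).mpr ⟨m, hm, hj⟩)) n c

/-- The translation `x₁ ↦ x₁ + a` of the polynomial ring. -/
noncomputable def shiftHom (a : ℂ) : Fock →ₐ[ℂ] Fock :=
  aeval fun i => X i + C (if i = 1 then a else 0)

theorem shiftHom_X (a : ℂ) (i : ℕ+) :
    shiftHom a (X i) = X i + C (if i = 1 then a else 0) := by simp [shiftHom]

theorem shiftHom_C (a t : ℂ) : shiftHom a (C t) = C t := by simp [shiftHom]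

theorem shiftHom_comp (a b : ℂ) (h : a + b = 0) :
    (shiftHom a).comp (shiftHom b) = AlgHom.id ℂ Fock := by
  ext1 i
  rw [AlgHom.comp_apply, shiftHom_X, map_add, shiftHom_X, shiftHom_C, add_assoc, ← C_add,
    AlgHom.id_apply]
  split_ifs <;> simp [h]

/-- The automorphism `exp(a ∂/∂x₁)` of the Fock space. -/
noncomputable def shift (a : ℂ) : Fock ≃ₗ[ℂ] Fock :=
  (AlgEquiv.ofAlgHom (shiftHom a) (shiftHom (-a)) (shiftHom_comp _ _ (by ring))
    (shiftHom_comp _ _ (by ring))).toLinearEquiv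

theorem shift_apply (a : ℂ) (p : Fock) : shift a p = shiftHom a p := rfl

theorem shift_X_mul (a : ℂ) (i : ℕ+) (p : Fock) :
    shift a (X i * p) = X i * shift a p + (if i = 1 then a else 0) • shift a p := by
  rw [shift_apply, map_mul, shiftHom_X, add_mul, ← smul_eq_C_mul]
  rfl

theorem shift_pderiv (a : ℂ) (t : ℕ+) (p : Fock) :
    shift a (pderiv t p) = pderiv t (shift a p) := by
  classical
  induction p using MvPolynomial.induction_on with
  | C s => simp [shift_apply]
  | add p q hp hq => rw [map_add, map_add, map_add, map_add, hp, hq]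
  | mul_X p i hp =>
    have h : pderiv t (X i : Fock) = C (if t = i then 1 else 0) := by
      by_cases ht : t = i
      · subst ht
        simp
      · rw [pderiv_X_of_ne (Ne.symm ht), if_neg ht, C_0]
    rw [mul_comm p, shift_X_mul, map_add, pderiv_mul, pderiv_mul, map_add, shift_X_mul, hp, h,
      Derivation.map_smul, ← smul_eq_C_mul, ← smul_eq_C_mul, map_smul]
    abel

theorem shift_varMode (a : ℂ) (i : ℕ+) (j : ℤ) (p : Fock) :
    shift a (varMode i j p) =
      varMode i j (shift a p) + (if i = 1 ∧ j = -1 then a else 0) • shift a p := by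
  by_cases hj : j = -1
  · subst hj
    rw [varMode_neg_one, varMode_neg_one, shift_X_mul]
    simp
  · rw [if_neg (fun h => hj h.2), zero_smul, add_zero]
    rcases lt_or_ge j 0 with h | h
    · obtain ⟨γ, t, ht, h⟩ := varMode_of_lt i (j := j) (by omega)
      have h1 : t ≠ 1 := by
        rintro rfl
        exact absurd ht (by decide)
      rw [h, h, map_smul, shift_X_mul, if_neg h1, zero_smul, add_zero]
    · rcases varMode_of_nonneg i h with h | ⟨t, -, γ, h⟩
      · rw [h, LinearMap.zero_apply, LinearMap.zero_apply, map_zero]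
      · rw [h, h, map_smul, shift_pderiv]

theorem shift_monomial_of_two_le (a : ℂ) (m : ℕ+ →₀ ℕ) (h : ∀ j ∈ m.support, j ≠ 1) :
    shift a (monomial m 1) = monomial m 1 := by
  rw [shift_apply, shiftHom, aeval_monomial, monomial_eq]
  congr 1
  refine Finsupp.prod_congr fun j hj => ?_
  rw [if_neg (h j hj), C_0, add_zero]

theorem finsum_ite_and_eq {P : Prop} [Decidable P] (k : ℤ) (x : Fock) :
    ∑ᶠ j : ℤ, (if P ∧ j = k then x else 0) = if P then x else 0 := by
  rw [finsum_eq_single _ k (fun j hj => by rw [if_neg (fun h => hj h.2)])]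
  simp

theorem finite_support_ite_and {P : Prop} [Decidable P] (k : ℤ) (x : Fock) :
    (Function.support fun j : ℤ => if P ∧ j = k then x else 0).Finite :=
  (Set.finite_singleton k).subset fun j hj => by
    by_contra h
    exact hj (if_neg fun h' => h h'.2)

theorem shift_mode (a : ℂ) (b : Fock) (n : ℤ) (c : Fock) :
    shift a (mode b n c) = mode (shift a b) n (shift a c) := by
  suffices h : ∀ m : ℕ+ →₀ ℕ, ∀ n c, shift a (mode (monomial m 1) n c) =
      mode (shift a (monomial m 1)) n (shift a c) by
    refine sub_eq_zero.mp ((Submodule.mem_bot ℂ).mp (map_mem_of_support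
      ((shift a).toLinearMap.comp (modeLeft n c) -
        (modeLeft n (shift a c)).comp (shift a).toLinearMap) ⊥ b fun m _ => ?_))
    rw [Submodule.mem_bot, LinearMap.sub_apply, sub_eq_zero]
    exact h m n c
  intro m
  induction m using monomial_sorted_induction with
  | h0 =>
    intro n c
    have h1 : (monomial (0 : ℕ+ →₀ ℕ) (1 : ℂ)) = 1 := rfl
    rw [h1, shift_apply a 1, map_one, mode_one]
    split_ifs <;> simp
  | hX i m hm ih =>
    intro n c
    have hvars : ∀ j ∈ (shift a (monomial m 1)).vars, i ≤ j := by
      by_cases hi : i = 1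
      · subst hi
        exact fun _ _ => one_le
      · rw [shift_monomial_of_two_le a m fun j hj hj1 =>
          hi (le_antisymm (hj1 ▸ hm j hj) one_le)]
        intro j hj
        rw [vars_monomial one_ne_zero] at hj
        exact hm j hj
    rw [← X_mul_monomial, mode_X_mul i m hm, shift_X_mul, mode_add, LinearMap.add_apply,
      mode_X_mul_of_vars i _ hvars, mode_smul, LinearMap.smul_apply, ← ih]
    -- The extra term from `x_1 ↦ x_1 + a` is placed at `j = -1`, the index at which `shift_varMode`
    -- produces it, so that the two sums agree termwise.
    have e : (if i = 1 then a else 0) • shift a (mode (monomial m 1) n c) =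
        ∑ᶠ j : ℤ, if i = 1 ∧ j = -1 then a • shift a (mode (monomial m 1) n c) else 0 := by
      rw [finsum_ite_and_eq]
      split_ifs <;> simp
    rw [e, ← finsum_add_distrib (mode_X_mul_finite i _ n _) (finite_support_ite_and _ _)]
    refine ((shift a).toLinearMap.toAddMonoidHom.map_finsum
      (mode_X_mul_finite i (monomial m 1) n c)).trans (finsum_congr fun j => ?_)
    change shift a _ = _
    unfold normalOrderVarTerm
    by_cases hj : j < 0
    · rw [if_pos hj, if_pos hj, shift_varMode, ih]
      congr 1
      split_ifs with h
      · rw [h.2, ← ih, show n - 1 - -1 = n by ring]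
      · rw [zero_smul]
    · rw [if_neg hj, if_neg hj, ih, shift_varMode, if_neg (by omega), if_neg (by omega), zero_smul,
        add_zero, add_zero]

theorem shift_mem_vertexAut (a : ℂ) : shift a ∈ vertexAut := fun n b c => shift_mode a b n c

/-! ### The derivation `∂/∂x_1` and its exponential -/

theorem pderiv_pderiv_comm (i j : ℕ+) (p : Fock) :
    pderiv i (pderiv j p) = pderiv j (pderiv i p) := by
  by_cases h : i = j
  · rw [h]
  · ext m
    rw [coeff_pderiv, coeff_pderiv, coeff_pderiv, coeff_pderiv, add_right_comm, Finsupp.add_apply,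
      Finsupp.add_apply, Finsupp.single_eq_of_ne h, Finsupp.single_eq_of_ne (Ne.symm h)]
    push_cast
    ring

theorem pderiv_one_varMode (i : ℕ+) (j : ℤ) (p : Fock) :
    pderiv 1 (varMode i j p) = varMode i j (pderiv 1 p) + if i = 1 ∧ j = -1 then p else 0 := by
  by_cases hj : j = -1
  · subst hj
    rw [varMode_neg_one, varMode_neg_one, pderiv_mul, add_comm]
    by_cases hi : i = 1
    · simp [hi]
    · simp [hi, pderiv_X_of_ne hi]
  · rw [if_neg (fun h => hj h.2), add_zero]
    rcases lt_or_ge j 0 with h | h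
    · obtain ⟨γ, t, ht, h⟩ := varMode_of_lt i (j := j) (by omega)
      have h1 : t ≠ 1 := by
        rintro rfl
        exact absurd ht (by decide)
      rw [h, h, Derivation.map_smul, pderiv_mul, pderiv_X_of_ne h1, zero_mul, zero_add]
    · rcases varMode_of_nonneg i h with h | ⟨t, -, γ, h⟩
      · rw [h, LinearMap.zero_apply, LinearMap.zero_apply, map_zero]
      · rw [h, h, Derivation.map_smul, pderiv_pderiv_comm]

theorem isVertexDerivation_pderiv_one : IsVertexDerivation (pderiv 1).toLinearMap := by
  intro n b c
  change pderiv 1 (mode b n c) = mode (pderiv 1 b) n c + mode b n (pderiv 1 c)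
  suffices h : ∀ m : ℕ+ →₀ ℕ, ∀ n c, pderiv 1 (mode (monomial m 1) n c) =
      mode (pderiv 1 (monomial m 1)) n c + mode (monomial m 1) n (pderiv 1 c) by
    refine sub_eq_zero.mp ((Submodule.mem_bot ℂ).mp (map_mem_of_support
      ((pderiv 1).toLinearMap.comp (modeLeft n c) -
        ((modeLeft n c).comp (pderiv 1).toLinearMap + modeLeft n (pderiv 1 c))) ⊥ b fun m _ => ?_))
    rw [Submodule.mem_bot, LinearMap.sub_apply, sub_eq_zero]
    exact h m n c
  intro m
  induction m using monomial_sorted_induction with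
  | h0 =>
    intro n c
    have h1 : (monomial (0 : ℕ+ →₀ ℕ) (1 : ℂ)) = 1 := rfl
    rw [h1, pderiv_one, mode_one]
    split_ifs <;> simp [mode]
  | hX i m hm ih =>
    intro n c
    have hvars : ∀ j ∈ (pderiv 1 (monomial m (1 : ℂ))).vars, i ≤ j := by
      by_cases hi : i = 1
      · subst hi
        exact fun _ _ => one_le
      · rw [pderiv_eq_zero_of_notMem_vars]
        · simp
        · rw [vars_monomial one_ne_zero]
          exact fun h => hi (le_antisymm (hm 1 h) one_le)
    have hD : pderiv 1 (X i * monomial m (1 : ℂ)) =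
        X i * pderiv 1 (monomial m 1) + if i = 1 then monomial m 1 else 0 := by
      rw [pderiv_mul, add_comm]
      by_cases hi : i = 1
      · simp [hi]
      · simp [hi, pderiv_X_of_ne hi]
    rw [← X_mul_monomial, mode_X_mul i m hm, mode_X_mul i m hm, hD, mode_add, LinearMap.add_apply,
      mode_X_mul_of_vars i _ hvars]
    have e : mode (if i = 1 then monomial m 1 else 0) n c =
        ∑ᶠ j : ℤ, if i = 1 ∧ j = -1 then mode (monomial m 1) n c else 0 := by
      rw [finsum_ite_and_eq]
      split_ifs <;> simp [mode]
    rw [e, ← finsum_add_distrib (mode_X_mul_finite i _ n _) (finite_support_ite_and _ _),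
      ← finsum_add_distrib _ (mode_X_mul_finite i _ n _)]
    · refine ((pderiv 1).toLinearMap.toAddMonoidHom.map_finsum
        (mode_X_mul_finite i (monomial m 1) n c)).trans (finsum_congr fun j => ?_)
      change pderiv 1 _ = _
      unfold normalOrderVarTerm
      by_cases hj : j < 0
      · rw [if_pos hj, if_pos hj, if_pos hj, pderiv_one_varMode, ih, map_add]
        have : (if i = 1 ∧ j = -1 then mode (monomial m 1) (n - 1 - j) c else 0) =
            if i = 1 ∧ j = -1 then mode (monomial m 1) n c else 0 := by
          split_ifs with h
          · rw [h.2, show n - 1 - -1 = n by ring]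
          · rfl
        rw [this]
        abel
      · rw [if_neg hj, if_neg hj, if_neg hj, ih, pderiv_one_varMode, if_neg (by omega),
          if_neg (by omega), add_zero, add_zero]
    · exact ((mode_X_mul_finite i _ n c).union (finite_support_ite_and _ _)).subset
        (Function.support_add _ _)

theorem heis_one : heis 1 = (pderiv 1).toLinearMap := by
  have h := heis_coe 1
  simpa using h

theorem smul_heis_one_apply (a : ℂ) (p : Fock) : (a • heis 1) p = a • pderiv 1 p := by
  rw [heis_one]
  rfl

theorem smul_heis_one_pow_X_mul (a : ℂ) (i : ℕ+) (p : Fock) (k : ℕ) :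
    ((a • heis 1) ^ (k + 1)) (X i * p) = X i * ((a • heis 1) ^ (k + 1)) p +
      ((k + 1 : ℂ) * if i = 1 then a else 0) • ((a • heis 1) ^ k) p := by
  have h : ∀ p, (a • heis 1) (X i * p) = X i * (a • heis 1) p + (if i = 1 then a else 0) • p := by
    intro p
    rw [smul_heis_one_apply, smul_heis_one_apply, pderiv_mul]
    by_cases hi : i = 1
    · subst hi
      simp [add_comm]
    · simp [pderiv_X_of_ne hi, hi]
  induction k with
  | zero => simp [h]
  | succ k ih =>
    rw [pow_succ', Module.End.mul_apply, ih, map_add, h, map_smul, ← Module.End.mul_apply,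
      ← pow_succ', ← Module.End.mul_apply, ← pow_succ', add_assoc, ← add_smul]
    congr 2
    push_cast
    ring

theorem isExp_shift (a : ℂ) : IsExp (a • heis 1) (shift a) := by
  intro p
  induction p using MvPolynomial.induction_on with
  | C t =>
    intro f
    convert hasSum_single 0 ?_ using 1
    · simp [shift_apply]
    · intro k hk
      obtain ⟨k, rfl⟩ := Nat.exists_eq_succ_of_ne_zero hk
      rw [pow_succ, Module.End.mul_apply, smul_heis_one_apply, pderiv_C, smul_zero, map_zero,
        map_zero, mul_zero]
  | add p q hp hq =>
    intro f
    simp only [map_add, mul_add]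
    exact (hp f).add (hq f)
  | mul_X p i hp =>
    intro f
    rw [mul_comm p]
    have h1 := hp (f.comp (LinearMap.mulLeft ℂ (X i)))
    have h2 := (hp f).mul_left (if i = 1 then a else 0)
    -- After division by `(k+1)!`, commuting `D^{k+1}` past `x_i` leaves a multiple of the `k`-th
    -- term of the series for `p`; thus `g` is that series shifted by one.
    let g : ℕ → ℂ := fun k => (k.factorial : ℂ)⁻¹ * f (((a • heis 1) ^ k) (X i * p)) -
      (k.factorial : ℂ)⁻¹ * (f.comp (LinearMap.mulLeft ℂ (X i))) (((a • heis 1) ^ k) p)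
    have hg0 : g 0 = 0 := by simp [g]
    have hg : HasSum g ((if i = 1 then a else 0) * f (shift a p)) := by
      have hsucc : (fun k => g (k + 1)) = fun k : ℕ =>
          (if i = 1 then a else 0) * ((k.factorial : ℂ)⁻¹ * f (((a • heis 1) ^ k) p)) := by
        funext k
        have hk : ((k.factorial : ℂ)) ≠ 0 := by exact_mod_cast k.factorial_ne_zero
        have hk1 : (k + 1 : ℂ) ≠ 0 := by exact_mod_cast k.succ_ne_zero
        simp only [g, smul_heis_one_pow_X_mul, LinearMap.comp_apply, LinearMap.mulLeft_apply, map_add,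
          map_smul, Nat.factorial_succ, smul_eq_mul]
        push_cast
        field_simp
        ring
      have h3 := (hasSum_nat_add_iff 1).mp (hsucc ▸ h2)
      rwa [Finset.sum_range_one, hg0, add_zero] at h3
    convert h1.add hg using 1
    · funext k
      simp only [g]
      ring
    · rw [shift_X_mul, map_add, map_smul, smul_eq_mul]
      rfl

theorem isExpInner_shift (a : ℂ) : IsExpInner 1 (shift a) := by
  refine ⟨shift_mem_vertexAut a, a • heis 1, ⟨⟨a • X 1, fun j hj => ?_, ?_⟩, fun n b c => ?_⟩,
    isExp_shift a⟩
  · obtain rfl : j = 0 := by omega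
    rw [mode_smul, mode_X, Nat.cast_zero, varMode_of_lt_index 1 le_rfl (by norm_num), smul_zero]
  · refine LinearMap.ext fun p => ?_
    rw [smul_heis_one_apply, mode_smul, mode_X, LinearMap.smul_apply, Nat.cast_one, varMode_one_one]
  · have h := isVertexDerivation_pderiv_one n b c
    rw [smul_heis_one_apply, smul_heis_one_apply, smul_heis_one_apply, mode_smul,
      LinearMap.smul_apply, map_smul, ← smul_add]
    exact congrArg (a • ·) h

theorem shift_mem_innerAut (a : ℂ) : shift a ∈ innerAut :=
  (le_iSup innerAutLevel 1 : _) (Subgroup.subset_closure (isExpInner_shift a))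

/-! ### Normal form of a conformal vector -/

theorem IsConformalVector.map {v : Fock} (hv : IsConformalVector v) {σ : Fock ≃ₗ[ℂ] Fock}
    (hσ : σ ∈ vertexAut) : IsConformalVector (σ v) := by
  have hT : ∀ p, translation (σ p) = σ (translation p) := fun p => by
    change mode (σ p) (-2) 1 = σ (mode p (-2) 1)
    rw [hσ, vertexAut_map_one hσ]
  obtain ⟨⟨h0, h4, ⟨c, h3⟩, h2, h1, hm⟩, hs, ht⟩ := hv
  refine ⟨⟨fun h => h0 ((map_eq_zero_iff σ σ.injective).mp h), fun n hn => ?_, ⟨c, ?_⟩, ?_, ?_, ?_⟩,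
    ?_, ?_⟩
  · rw [← hσ, h4 n hn, map_zero]
  · rw [← hσ, h3, vertexAut_map_C hσ]
  · rw [← hσ, h2, map_zero]
  · rw [← hσ, h1, map_smul]
  · rw [← hσ, hm, hT]
  · exact (LinearEquiv.isSemisimple_iff (mode v 1) (mode (σ v) 1) σ
      (LinearMap.ext fun p => hσ 1 v p)).mp hs
  · refine LinearMap.ext fun p => ?_
    obtain ⟨q, rfl⟩ := σ.surjective p
    rw [← hσ, ht, hT]

theorem shift_eq (a μ l : ℂ) : shift a (C (μ ^ 2 / 2) + μ • X 1 + standardVector l) =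
    C ((μ + a) ^ 2 / 2) + (μ + a) • X 1 + standardVector l := by
  have h12 : (2 : ℕ+) ≠ 1 := by decide
  have e : ((μ + a) ^ 2 / 2 : ℂ) = μ ^ 2 / 2 + μ * a + 1 / 2 * a ^ 2 := by ring
  rw [e]
  simp only [standardVector, shift_apply, map_add, map_pow, shiftHom_C, shiftHom_X,
    if_pos, if_neg h12, smul_eq_C_mul, map_mul, C_0]
  have h2 : (C (1 / 2) : Fock) * 2 = 1 := by
    have h : (2 : Fock) = C 2 := (map_ofNat C 2).symm
    rw [h, ← C_mul]
    norm_num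
  linear_combination (X 1 * C a) * h2

theorem coeff_single_one (s t l : ℂ) :
    coeff (Finsupp.single 1 1) (C s + t • X 1 + standardVector l) = t := by
  classical
  have h : Finsupp.single (1 : ℕ+) 2 ≠ Finsupp.single 1 1 := fun h => by
    have := congrArg Finsupp.degree h
    simp at this
  have h12 : Finsupp.single (2 : ℕ+) 1 ≠ Finsupp.single (1 : ℕ+) 1 := fun h => by
    have := (Finsupp.single_left_inj one_ne_zero).mp h
    exact absurd this (by decide)
  rw [standardVector, coeff_add, coeff_add, coeff_add, coeff_smul, coeff_smul, coeff_smul,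
    coeff_X_pow, coeff_X, coeff_X, coeff_C, if_neg h, if_neg h12, if_pos rfl,
    if_neg (Finsupp.single_ne_zero.mpr one_ne_zero).symm]
  simp

theorem isWeightedHomogeneous_standardVector (l : ℂ) :
    IsWeightedHomogeneous (fun i : ℕ+ => (i : ℕ)) (standardVector l) 2 := by
  have h1 := ((isWeightedHomogeneous_X ℂ (fun i : ℕ+ => (i : ℕ)) 1).pow 2)
  have h2 := isWeightedHomogeneous_X ℂ (fun i : ℕ+ => (i : ℕ)) 2
  exact ((weightedHomogeneousSubmodule ℂ _ 2).smul_mem _ h1).add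
    ((weightedHomogeneousSubmodule ℂ _ 2).smul_mem _ h2)

theorem mainTheorem6 :
    ∃ τ : ℂ → (Fock ≃ₗ[ℂ] Fock),
      (∀ a : ℂ, IsExp (a • heis 1) (τ a) ∧ IsExpInner 1 (τ a)) ∧
      ∀ v : Fock, IsConformalVector v →
        (∃! w : Fock, (IsConformalVector w ∧ ∃ l : ℂ, w = standardVector l) ∧
          ∃ σ ∈ innerAut, σ v = w) ∧
        ∃ μ l : ℂ,
          v = MvPolynomial.C (μ ^ 2 / 2) + μ • MvPolynomial.X 1 + standardVector l ∧
          τ (-μ) v = standardVector l ∧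
          (∀ a : ℂ, (∃ l' : ℂ, τ a v = standardVector l') ↔ a = -μ) ∧
          ∀ a : ℂ, MvPolynomial.IsWeightedHomogeneous (fun i : ℕ+ => (i : ℕ)) (τ a v) 2 ↔
            a = -μ := by
  refine ⟨shift, fun a => ⟨isExp_shift a, isExpInner_shift a⟩, fun v hv => ?_⟩
  obtain ⟨μ, l, rfl⟩ := hv.1.eq_standardVector
  have hstd : shift (-μ) (C (μ ^ 2 / 2) + μ • X 1 + standardVector l) = standardVector l := by
    rw [shift_eq]
    simp
  have hzero : (C 0 : Fock) + (0 : ℂ) • X 1 + standardVector l = standardVector l := by simp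
  refine ⟨⟨standardVector l, ⟨⟨?_, l, rfl⟩, shift (-μ), shift_mem_innerAut _, hstd⟩, ?_⟩,
    μ, l, rfl, hstd, fun a => ⟨?_, ?_⟩, fun a => ⟨?_, ?_⟩⟩
  · exact hstd ▸ hv.map (shift_mem_vertexAut (-μ))
  · rintro w ⟨⟨-, l', rfl⟩, σ, hσ, h⟩
    -- This inner automorphism sends one standard vector to the other, so their parameters agree.
    have hmem : σ * (shift (-μ))⁻¹ ∈ translationAut :=
      innerAut_le_translationAut (mul_mem hσ (inv_mem (shift_mem_innerAut _)))
    rw [translationAut_standardVector hmem (l := l) (l' := l')]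
    rw [LinearEquiv.mul_apply, ← h]
    congr 1
    exact (shift (-μ)).symm_apply_eq.mpr hstd.symm
  · rintro ⟨l', h⟩
    have h1 := congrArg (coeff (Finsupp.single 1 1)) h
    have h2 := coeff_single_one 0 0 l'
    rw [C_0, zero_smul, zero_add, zero_add] at h2
    rw [shift_eq, coeff_single_one, h2] at h1
    linear_combination h1
  · rintro rfl
    exact ⟨l, hstd⟩
  · intro h
    by_contra hne
    -- The coefficient of `x_1` is `μ + a`, and `x_1` has weight `1`, not `2`.
    have h1 : coeff (Finsupp.single 1 1) (shift a (C (μ ^ 2 / 2) + μ • X 1 + standardVector l))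
        ≠ 0 := by
      rw [shift_eq, coeff_single_one]
      exact fun h0 => hne (by linear_combination h0)
    have h2 := h h1
    simp [Finsupp.weight_apply] at h2
  · rintro rfl
    rw [hstd]
    exact isWeightedHomogeneous_standardVector l
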